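/- Let $(M,g)$ be a smooth Riemannian manifold of real dimension $4$ with a smooth $g$-orthogonal almost complex structure $J$ that is integrable, i.e. whose Nijenhuis tensor $N(A,B)=[JA,JB]-[A,B]-J[JA,B]-J[A,JB]$ vanishes (a Hermitian surface). Let $\omega(X,Y)=g(JX,Y)$ be the fundamental $2$-form, let $J$ act on $1$-forms by $(J\alpha)(X)=-\alpha(JX)$, let $\nabla$ be the Levi-Civita connection, with curvature tensor $R$, and let $\delta$ be the codifferential, $\delta\beta=-\sum_i(\nabla_{e_i}\beta)(e_i,\cdot)$ for local orthonormal frames $(e_i)$. Let $\theta=J\delta\omega$ be the Lee form (equivalently, $d\omega=\theta\wedge\omega$). For a $2$-tensor $\psi$ denote by $\psi''(X,Y)=\tfrac12\big(\psi(X,Y)-\psi(JX,JY)\big)$ its $J$-anti-invariant part. Then $(M,g,J)$ satisfies Gray's first condition $$R_{XYZW}=R_{XY\,JZ\,JW}\quad\text{for all tangent vectors }X,Y,Z,W$$ if and only if both $$2\,\delta\theta=-|\theta|^2\qquad\text{and}\qquad(\nabla\theta)''=-\tfrac14\big(\theta\otimes\theta-J\theta\otimes J\theta\big)$$ hold on $M$,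 where $(\nabla\theta)(X,Y)=(\nabla_X\theta)(Y)$. -/

import Mathlib

open Bundle FiberBundle VectorField
open scoped Manifold ContDiff

noncomputable section

namespace HermitianSurface

section LeviCivita

variable {E : Type*} [NormedAddCommGroup E] [NormedSpace ℝ E]
  {H : Type*} [TopologicalSpace H] (I : ModelWithCorners ℝ E H)
  {M : Type*} [TopologicalSpace M] [ChartedSpace H M] [IsManifold I ∞ M]
  [RiemannianBundle (fun x : M ↦ TangentSpace I x)]
  
/-- The right-hand side of the Koszul formula for `2 ⟨∇_X Y, Z⟩`. -/
def koszul (Y X Z : Π x : M, TangentSpace I x) (x : M) : ℝ :=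
  mvfderiv I (fun y ↦ inner ℝ (Y y) (Z y)) x (X x)
    + mvfderiv I (fun y ↦ inner ℝ (Z y) (X y)) x (Y x)
    - mvfderiv I (fun y ↦ inner ℝ (X y) (Y y)) x (Z x)
    + inner ℝ (mlieBracket I X Y x) (Z x)
    - inner ℝ (mlieBracket I Y Z x) (X x)
    - inner ℝ (mlieBracket I X Z x) (Y x)

variable {I}

theorem eq_of_forall_inner {x : M} {v w : TangentSpace I x}
    (h : ∀ Z : Π x : M, TangentSpace I x, MDiffAt (T% Z) x →
      (inner ℝ v (Z x) : ℝ) = inner ℝ w (Z x)) : v = w := by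
  refine ext_inner_right ℝ fun z ↦ ?_
  simpa using h (extend E z) (mdifferentiableAt_extend I E z)

variable [IsContMDiffRiemannianBundle I ∞ E (fun x : M ↦ TangentSpace I x)]

theorem mdifferentiableAt_inner {x : M} {X Y : Π x : M, TangentSpace I x}
    (hX : MDiffAt (T% X) x) (hY : MDiffAt (T% Y) x) :
    MDiffAt (fun y ↦ (inner ℝ (X y) (Y y) : ℝ)) x :=
  MDifferentiableAt.inner_bundle (E := fun x : M ↦ TangentSpace I x) (F := E) (b := fun y ↦ y)
    (IB := I) hX hY

variable [FiniteDimensional ℝ E]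

theorem koszul_tensorial_left {x : M} {Y Z : Π x : M, TangentSpace I x}
    (hY : MDiffAt (T% Y) x) (hZ : MDiffAt (T% Z) x) :
    TensorialAt I E (koszul I Y · Z x) x where
  smul {f X} hf hX := by
    have h1 := mvfderiv_fun_mul hf (mdifferentiableAt_inner hZ hX)
    have h2 := mvfderiv_fun_mul hf (mdifferentiableAt_inner hX hY)
    simp [koszul, inner_smul_left, inner_smul_right, h1, h2, inner_add_left,
      mlieBracket_smul_left hf hX]
    rw [real_inner_comm (Y x) (X x), real_inner_comm (Z x) (X x)]
    ring
  add {X X'} hX hX' := by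
    have h1 := mvfderiv_fun_add (mdifferentiableAt_inner hZ hX) (mdifferentiableAt_inner hZ hX')
    have h2 := mvfderiv_fun_add (mdifferentiableAt_inner hX hY) (mdifferentiableAt_inner hX' hY)
    simp [koszul, h1, h2, inner_add_left, inner_add_right,
      mlieBracket_add_left hX hX']
    ring

theorem koszul_tensorial_right {x : M} {Y X : Π x : M, TangentSpace I x}
    (hY : MDiffAt (T% Y) x) (hX : MDiffAt (T% X) x) :
    TensorialAt I E (koszul I Y X · x) x where
  smul {f Z} hf hZ := by
    have h1 := mvfderiv_fun_mul hf (mdifferentiableAt_inner hY hZ)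
    have h2 := mvfderiv_fun_mul hf (mdifferentiableAt_inner hZ hX)
    simp [koszul, inner_smul_left, inner_smul_right, h1, h2, inner_add_left,
      mlieBracket_smul_right hf hZ]
    rw [real_inner_comm (Y x) (Z x)]
    ring
  add {Z Z'} hZ hZ' := by
    have h1 := mvfderiv_fun_add (mdifferentiableAt_inner hY hZ) (mdifferentiableAt_inner hY hZ')
    have h2 := mvfderiv_fun_add (mdifferentiableAt_inner hZ hX) (mdifferentiableAt_inner hZ' hX)
    simp [koszul, h1, h2, inner_add_left, inner_add_right,
      mlieBracket_add_right hZ hZ']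
    ring

instance (x : M) : FiniteDimensional ℝ (TangentSpace I x) :=
  inferInstanceAs (FiniteDimensional ℝ E)

/-- The Koszul formula as a bilinear form in the values of `X` and `Z` at `x`. -/
def koszulForm {Y : Π x : M, TangentSpace I x} {x : M} (hY : MDiffAt (T% Y) x) :
    TangentSpace I x →L[ℝ] TangentSpace I x →L[ℝ] ℝ :=
  TensorialAt.mkHom₂ (F := E) (F' := E) (fun X Z ↦ koszul I Y X Z x) x
    (fun _ hZ ↦ koszul_tensorial_left hY hZ) (fun _ hX ↦ koszul_tensorial_right hY hX)

theorem koszulForm_apply {Y X Z : Π x : M, TangentSpace I x} {x : M} (hY : MDiffAt (T% Y) x)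
    (hX : MDiffAt (T% X) x) (hZ : MDiffAt (T% Z) x) :
    koszulForm hY (X x) (Z x) = koszul I Y X Z x :=
  TensorialAt.mkHom₂_apply (F := E) (F' := E) (fun _ hZ ↦ koszul_tensorial_left hY hZ)
    (fun _ hX ↦ koszul_tensorial_right hY hX) hX hZ

open scoped Classical in
/-- `∇Y` at `x`, obtained from the Koszul formula with the help of an orthonormal basis of `T_x M`.
The value at a vector field that is not differentiable at `x` is irrelevant. -/
def leviCivitaFun (Y : Π y : M, TangentSpace I y) (x : M) :
    TangentSpace I x →L[ℝ] TangentSpace I x :=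
  if hY : MDiffAt (T% Y) x then
    ∑ i, ((2⁻¹ : ℝ) • (koszulForm hY).flip (stdOrthonormalBasis ℝ (TangentSpace I x) i)).smulRight
      (stdOrthonormalBasis ℝ (TangentSpace I x) i)
  else 0

theorem inner_leviCivitaFun {Y X Z : Π x : M, TangentSpace I x} {x : M} (hY : MDiffAt (T% Y) x)
    (hX : MDiffAt (T% X) x) (hZ : MDiffAt (T% Z) x) :
    inner ℝ (leviCivitaFun Y x (X x)) (Z x) = 2⁻¹ * koszul I Y X Z x := by
  rw [← koszulForm_apply hY hX hZ, leviCivitaFun, dif_pos hY]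
  generalize Z x = z
  conv_rhs => rw [← (stdOrthonormalBasis ℝ (TangentSpace I x)).sum_repr z]
  simp [sum_inner, inner_smul_left, Finset.mul_sum, OrthonormalBasis.repr_apply_apply]
  refine Finset.sum_congr rfl fun i _ ↦ ?_
  ring

theorem isCovariantDerivativeOn_leviCivitaFun :
    IsCovariantDerivativeOn E (leviCivitaFun (I := I) (M := M)) Set.univ where
  add {Y Y'} x hY hY' _ := by
    ext v
    obtain ⟨X, hX, rfl⟩ : ∃ X : Π x : M, TangentSpace I x, MDiffAt (T% X) x ∧ X x = v :=
      ⟨extend E v, mdifferentiableAt_extend I E v, by simp⟩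
    refine eq_of_forall_inner fun Z hZ ↦ ?_
    have hYY : MDiffAt (T% (Y + Y')) x := mdifferentiableAt_add_section hY hY'
    have h1 := mvfderiv_fun_add (mdifferentiableAt_inner hY hZ) (mdifferentiableAt_inner hY' hZ)
    have h2 := mvfderiv_fun_add (mdifferentiableAt_inner hX hY) (mdifferentiableAt_inner hX hY')
    rw [add_apply, inner_add_left, inner_leviCivitaFun hYY hX hZ,
      inner_leviCivitaFun hY hX hZ, inner_leviCivitaFun hY' hX hZ]
    simp [koszul, h1, h2, inner_add_left, inner_add_right,
      mlieBracket_add_left hY hY', mlieBracket_add_right hY hY']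
    ring
  leibniz {Y f} x hY hf _ := by
    ext v
    obtain ⟨X, hX, rfl⟩ : ∃ X : Π x : M, TangentSpace I x, MDiffAt (T% X) x ∧ X x = v :=
      ⟨extend E v, mdifferentiableAt_extend I E v, by simp⟩
    refine eq_of_forall_inner fun Z hZ ↦ ?_
    have hfY : MDiffAt (T% (f • Y)) x := hf.smul_section hY
    have h1 := mvfderiv_fun_mul hf (mdifferentiableAt_inner hY hZ)
    have h2 := mvfderiv_fun_mul hf (mdifferentiableAt_inner hX hY)
    rw [add_apply, inner_add_left, inner_leviCivitaFun hfY hX hZ,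
      smul_apply, inner_smul_left, inner_leviCivitaFun hY hX hZ]
    simp [koszul, inner_smul_left, inner_smul_right, h1, h2, inner_add_left,
      mlieBracket_smul_left hf hY, mlieBracket_smul_right hf hY]
    rw [real_inner_comm (Y x) (X x)]
    ring

variable (I M) in
/-- The Levi-Civita connection; `leviCivita I M Y x v` is `(∇_v Y)(x)`. -/
def leviCivita : CovariantDerivative I E (fun x : M ↦ TangentSpace I x) where
  toFun := leviCivitaFun
  isCovariantDerivativeOnUniv := isCovariantDerivativeOn_leviCivitaFun

/-- The Levi-Civita connection is torsion-free. -/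
theorem leviCivita_sub_swap {X Y : Π x : M, TangentSpace I x} {x : M}
    (hX : MDiffAt (T% X) x) (hY : MDiffAt (T% Y) x) :
    leviCivita I M Y x (X x) - leviCivita I M X x (Y x) = mlieBracket I X Y x := by
  refine eq_of_forall_inner fun Z hZ ↦ ?_
  change inner ℝ (leviCivitaFun Y x (X x) - leviCivitaFun X x (Y x)) (Z x) = _
  rw [inner_sub_left, inner_leviCivitaFun hY hX hZ, inner_leviCivitaFun hX hY hZ]
  have h := mlieBracket_swap_apply (I := I) (V := Y) (W := X) (x := x)
  simp only [koszul, h, inner_neg_left, real_inner_comm]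
  ring

/-- The Levi-Civita connection is compatible with the metric. -/
theorem mvfderiv_inner_eq {X Y Z : Π x : M, TangentSpace I x} {x : M}
    (hX : MDiffAt (T% X) x) (hY : MDiffAt (T% Y) x) (hZ : MDiffAt (T% Z) x) :
    mvfderiv I (fun y ↦ (inner ℝ (Y y) (Z y) : ℝ)) x (X x) =
      inner ℝ (leviCivita I M Y x (X x)) (Z x) + inner ℝ (Y x) (leviCivita I M Z x (X x)) := by
  change _ = inner ℝ (leviCivitaFun Y x (X x)) (Z x) + inner ℝ (Y x) (leviCivitaFun Z x (X x))
  rw [real_inner_comm (leviCivitaFun Z x (X x)), inner_leviCivitaFun hY hX hZ,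
    inner_leviCivitaFun hZ hX hY]
  have h := mlieBracket_swap_apply (I := I) (V := Z) (W := Y) (x := x)
  simp only [koszul, h, inner_neg_left, real_inner_comm]
  ring

end LeviCivita

section Tensors

variable {E : Type*} [NormedAddCommGroup E] [NormedSpace ℝ E] [FiniteDimensional ℝ E]
  {H : Type*} [TopologicalSpace H] {I : ModelWithCorners ℝ E H}
  {M : Type*} [TopologicalSpace M] [ChartedSpace H M] [IsManifold I ∞ M]
  [RiemannianBundle (fun x : M ↦ TangentSpace I x)]
  [IsContMDiffRiemannianBundle I ∞ E (fun x : M ↦ TangentSpace I x)]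

/-! Values of tensors at a point are computed with the help of the vector fields `extend E v`: such
a field is smooth near the base point `x` of `v` and has the value `v` at `x`. By tensoriality the
choice of the extension does not matter. -/

/-- The vector field `R_{X,Y} Z = ∇_X ∇_Y Z - ∇_Y ∇_X Z - ∇_{[X,Y]} Z`. -/
def curvature (X Y Z : Π x : M, TangentSpace I x) (x : M) : TangentSpace I x :=
  leviCivita I M (fun y ↦ leviCivita I M Z y (Y y)) x (X x)
    - leviCivita I M (fun y ↦ leviCivita I M Z y (X y)) x (Y x)
    - leviCivita I M Z x (mlieBracket I X Y x)

/-- The Riemannian curvature tensor `R_{uvwz} = ⟨R_{u,v} w, z⟩` at the point `x`. -/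
def riemann (x : M) (u v w z : TangentSpace I x) : ℝ :=
  inner ℝ (curvature (extend E u) (extend E v) (extend E w) x) z

/-- The covariant derivative of a 1-form: `covDerivOne α x v w` is `(∇_v α)(w)`. -/
def covDerivOne (α : Π x : M, TangentSpace I x → ℝ) (x : M) (v w : TangentSpace I x) : ℝ :=
  mvfderiv I (fun y ↦ α y (extend E w y)) x v - α x (leviCivita I M (extend E w) x v)

/-- The covariant derivative of a 2-tensor: `covDerivTwo β x u v w` is `(∇_u β)(v, w)`. -/
def covDerivTwo (β : Π x : M, TangentSpace I x → TangentSpace I x → ℝ) (x : M)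
    (u v w : TangentSpace I x) : ℝ :=
  mvfderiv I (fun y ↦ β y (extend E v y) (extend E w y)) x u
    - β x (leviCivita I M (extend E v) x u) w - β x v (leviCivita I M (extend E w) x u)

/-- The codifferential of a 1-form, `δα = -∑ᵢ (∇_{eᵢ} α)(eᵢ)`. -/
def codiffOne (α : Π x : M, TangentSpace I x → ℝ) (x : M) : ℝ :=
  -∑ i, covDerivOne α x (stdOrthonormalBasis ℝ (TangentSpace I x) i)
    (stdOrthonormalBasis ℝ (TangentSpace I x) i)

/-- The codifferential of a 2-form, `(δβ)(w) = -∑ᵢ (∇_{eᵢ} β)(eᵢ, w)`. -/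
def codiffTwo (β : Π x : M, TangentSpace I x → TangentSpace I x → ℝ) (x : M)
    (w : TangentSpace I x) : ℝ :=
  -∑ i, covDerivTwo β x (stdOrthonormalBasis ℝ (TangentSpace I x) i)
    (stdOrthonormalBasis ℝ (TangentSpace I x) i) w

/-- The squared pointwise norm `|α|² = ∑ᵢ α(eᵢ)²` of a 1-form. -/
def normSqOne (α : Π x : M, TangentSpace I x → ℝ) (x : M) : ℝ :=
  ∑ i, α x (stdOrthonormalBasis ℝ (TangentSpace I x) i) ^ 2

variable (J : Π x : M, TangentSpace I x →L[ℝ] TangentSpace I x)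

/-- The Nijenhuis tensor `N(A, B) = [JA, JB] - [A, B] - J[JA, B] - J[A, JB]`. -/
def nijenhuis (A B : Π x : M, TangentSpace I x) (x : M) : TangentSpace I x :=
  mlieBracket I (fun y ↦ J y (A y)) (fun y ↦ J y (B y)) x - mlieBracket I A B x
    - J x (mlieBracket I (fun y ↦ J y (A y)) B x) - J x (mlieBracket I A (fun y ↦ J y (B y)) x)

/-- `J` is a Hermitian structure on the Riemannian manifold `M`: a smooth almost complex structure
that is orthogonal for the metric and integrable (its Nijenhuis tensor vanishes). -/
structure IsHermitian : Prop where
  contMDiff : ContMDiff I (I.prod 𝓘(ℝ, E →L[ℝ] E)) ∞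
    (fun x ↦ TotalSpace.mk' (E →L[ℝ] E) (E := fun x : M ↦ TangentSpace I x →L[ℝ] TangentSpace I x)
      x (J x))
  sq (x : M) (v : TangentSpace I x) : J x (J x v) = -v
  orthogonal (x : M) (v w : TangentSpace I x) : (inner ℝ (J x v) (J x w) : ℝ) = inner ℝ v w
  integrable (A B : Π x : M, TangentSpace I x) (x : M) (hA : MDiffAt (T% A) x)
    (hB : MDiffAt (T% B) x) : nijenhuis J A B x = 0

/-- The fundamental 2-form `ω(v, w) = ⟨Jv, w⟩`. -/
def fundamentalForm (x : M) (v w : TangentSpace I x) : ℝ :=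
  inner ℝ (J x v) w

/-- The action of `J` on 1-forms, `(Jα)(v) = -α(Jv)`. -/
def actOne (α : Π x : M, TangentSpace I x → ℝ) (x : M) (v : TangentSpace I x) : ℝ :=
  -α x (J x v)

/-- The Lee form `θ = J δω` of an almost Hermitian structure in real dimension four. -/
def leeForm : Π x : M, TangentSpace I x → ℝ :=
  actOne J (codiffTwo (fundamentalForm J))

/-- The `J`-anti-invariant part `β''(v, w) = (β(v, w) - β(Jv, Jw)) / 2` of a 2-tensor. -/
def antiInvariantPart (β : Π x : M, TangentSpace I x → TangentSpace I x → ℝ) (x : M)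
    (v w : TangentSpace I x) : ℝ :=
  (β x v w - β x (J x v) (J x w)) / 2

/-- Gray's first curvature condition, `R_{uvwz} = R_{uv(Jw)(Jz)}`. -/
def GrayFirst : Prop :=
  ∀ (x : M) (u v w z : TangentSpace I x), riemann x u v w z = riemann x u v (J x w) (J x z)

end Tensors

end HermitianSurface

end

/-! Gray's condition says that every curvature operator R(u,v) commutes with J. By the Ricci
identity the commutator of R(u,v) with J is the alternated second derivative of J
(`IsHermitian.riemann_map_add`), so the condition reads ∇²_{u,v}J = ∇²_{v,u}J.

In real dimension four this is a condition on the Lee field T, dual to θ. Orthogonality of J makes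
each ∇_u J skew and anticommuting with J, and integrability gives ∇_{Ju}J = J∇_u J
(`IsHermitian.covDeriv_map_left`). Tensors with these symmetries form a space of real dimension
four, so they are fixed by their trace, which is T up to J (`two_smul_eq_of_trace`). Differentiating
the resulting formula for ∇J expresses ∇²J through J, T and B = ∇T
(`IsHermitian.inner_leviCivita_covDeriv`).

What remains is linear algebra on one tangent space (`forall_commutator_eq_zero_iff`). The
alternated form is skew in u, v and, as a 2-form in w, z, is J-anti-invariant, so it has 6 · 2
components. They are linear in B and quadratic in T. Besides the J-anti-invariant part of B and its
trace, they involve one further quantity, the ω-trace of dθ. It always vanishes: this is dθ ∧ ω = 0,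
obtained here from the pair symmetry of R. The vanishing of the other quantities is exactly the two
stated equations. -/

noncomputable section

namespace HermitianSurface

/-! ### Pointwise algebra: tensors with the symmetries of ∇J -/

section LinearAlgebra

variable {V : Type*} [NormedAddCommGroup V] [InnerProductSpace ℝ V]

theorem inner_map_eq_neg_inner_map {J : V →ₗ[ℝ] V} (hJ : ∀ v, J (J v) = -v)
    (hJo : ∀ v w, (inner ℝ (J v) (J w) : ℝ) = inner ℝ v w) (v w : V) :
    (inner ℝ (J v) w : ℝ) = -inner ℝ v (J w) := by
  rw [← hJo v (J w), hJ, inner_neg_right, neg_neg]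

theorem inner_map_self_eq_zero {J : V →ₗ[ℝ] V} (hJ : ∀ v, J (J v) = -v)
    (hJo : ∀ v w, (inner ℝ (J v) (J w) : ℝ) = inner ℝ v w) (v : V) :
    (inner ℝ (J v) v : ℝ) = 0 := by
  have := inner_map_eq_neg_inner_map hJ hJo v v
  rw [real_inner_comm] at this
  rw [real_inner_comm]
  linarith

/-- Take a unit vector e and a unit vector f orthogonal to e and Je. Since J is skew and orthogonal,
Jf is then orthogonal to e, Je and f as well. -/
theorem exists_adapted_orthonormalBasis (hV : Module.finrank ℝ V = 4)
    {J : V →ₗ[ℝ] V} (hJ : ∀ v, J (J v) = -v)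
    (hJo : ∀ v w, (inner ℝ (J v) (J w) : ℝ) = inner ℝ v w) :
    ∃ b : OrthonormalBasis (Fin 4) ℝ V, J (b 0) = b 1 ∧ J (b 1) = -b 0 ∧
      J (b 2) = b 3 ∧ J (b 3) = -b 2 := by
  have hfd : FiniteDimensional ℝ V := .of_finrank_pos (by omega)
  have hself := inner_map_self_eq_zero hJ hJo
  have hself' (v : V) : (inner ℝ v (J v) : ℝ) = 0 := by rw [real_inner_comm]; exact hself v
  have hn (v : V) (hv : ‖v‖ = 1) : ‖J v‖ = 1 := by
    rw [← sq_eq_sq₀ (norm_nonneg _) (by norm_num), ← real_inner_self_eq_norm_sq, hJo,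
      real_inner_self_eq_norm_sq, hv]
  have : Nontrivial V := Module.nontrivial_of_finrank_pos (R := ℝ) (by omega)
  obtain ⟨e, he⟩ := exists_norm_eq V (zero_le_one (α := ℝ))
  let W : Submodule ℝ V := Submodule.span ℝ (Set.range ![e, J e])
  have hW : Module.finrank ℝ W ≤ 2 := (finrank_range_le_card ![e, J e]).trans (by simp)
  have hWo : Nontrivial Wᗮ := by
    have := W.finrank_add_finrank_orthogonal
    exact Module.nontrivial_of_finrank_pos (R := ℝ) (by omega)
  obtain ⟨⟨f, hf⟩, hf1⟩ := exists_norm_eq Wᗮ (zero_le_one (α := ℝ))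
  replace hf1 : ‖f‖ = 1 := hf1
  have h1 : (inner ℝ e f : ℝ) = 0 :=
    (Submodule.mem_orthogonal W f).1 hf _ (Submodule.subset_span ⟨0, rfl⟩)
  have h2 : (inner ℝ (J e) f : ℝ) = 0 :=
    (Submodule.mem_orthogonal W f).1 hf _ (Submodule.subset_span ⟨1, rfl⟩)
  have h3 : (inner ℝ e (J f) : ℝ) = 0 := by
    have := inner_map_eq_neg_inner_map hJ hJo e f
    linarith
  have hon : Orthonormal ℝ ![e, J e, f, J f] := by
    rw [orthonormal_iff_ite]
    have he2 : (inner ℝ e e : ℝ) = 1 := by rw [real_inner_self_eq_norm_sq, he]; norm_num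
    have hf2 : (inner ℝ f f : ℝ) = 1 := by rw [real_inner_self_eq_norm_sq, hf1]; norm_num
    have h1' : (inner ℝ f e : ℝ) = 0 := by rw [real_inner_comm]; exact h1
    have h2' : (inner ℝ f (J e) : ℝ) = 0 := by rw [real_inner_comm]; exact h2
    have h3' : (inner ℝ (J f) e : ℝ) = 0 := by rw [real_inner_comm]; exact h3
    intro i j
    fin_cases i <;> fin_cases j <;> simp [hJo, hself, hself', he, hf1, hn e he, hn f hf1, h1, h2, h3, h1', h2', h3']
  refine ⟨OrthonormalBasis.mk hon ?_, ?_⟩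
  · refine (hon.linearIndependent.span_eq_top_of_card_eq_finrank ?_).ge
    simp [hV]
  · simp [hJ]

theorem eq_zero_of_forall_orthonormalBasis {ι : Type*} [Fintype ι] (b : OrthonormalBasis ι ℝ V)
    {f : V → ℝ} (hadd : ∀ x y, f (x + y) = f x + f y) (hsmul : ∀ (c : ℝ) x, f (c • x) = c * f x)
    (h : ∀ i, f (b i) = 0) (v : V) : f v = 0 := by
  let F : V →ₗ[ℝ] ℝ := { toFun := f, map_add' := hadd, map_smul' := hsmul }
  have : F = 0 := b.toBasis.ext fun i ↦ by
    rw [OrthonormalBasis.coe_toBasis]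
    exact h i
  exact congr($this v)

/-- In real dimension four, a tensor with the symmetries of `∇J` on a Hermitian surface is
determined by its trace. -/
theorem two_smul_eq_of_trace (hV : Module.finrank ℝ V = 4)
    {J : V →ₗ[ℝ] V} (hJ : ∀ v, J (J v) = -v)
    (hJo : ∀ v w, (inner ℝ (J v) (J w) : ℝ) = inner ℝ v w)
    {D : V →ₗ[ℝ] V →ₗ[ℝ] V} (hskew : ∀ u v w, (inner ℝ (D u v) w : ℝ) = -inner ℝ v (D u w))
    (hanti : ∀ u v, D u (J v) = -J (D u v)) (hint : ∀ u v, D (J u) v = J (D u v))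
    {T : V} (hT : ∀ w, (inner ℝ T w : ℝ) = -LinearMap.trace ℝ V (D.flip (J w))) (u v : V) :
    (2 : ℝ) • D u v = (inner ℝ u v : ℝ) • J T - (inner ℝ (J T) v : ℝ) • u
      + (inner ℝ (J u) v : ℝ) • T - (inner ℝ T v : ℝ) • J u := by
  obtain ⟨b, h0, h1, h2, h3⟩ := exists_adapted_orthonormalBasis hV hJ hJo
  have hb (i j : Fin 4) : (inner ℝ (b i) (b j) : ℝ) = if i = j then 1 else 0 :=
    (orthonormal_iff_ite.1 b.orthonormal) i j
  have hself (u v : V) : (inner ℝ v (D u v) : ℝ) = 0 := by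
    have := hskew u v v
    rw [real_inner_comm] at this
    linarith
  have hself' (u v : V) : (inner ℝ (J v) (D u v) : ℝ) = 0 := by
    have e1 := hskew u v (J v)
    rw [hanti, inner_neg_right, neg_neg, real_inner_comm,
      inner_map_eq_neg_inner_map hJ hJo] at e1
    have e2 := inner_map_eq_neg_inner_map hJ hJo v (D u v)
    linarith
  -- Skewness and anticommutation with J make D u v orthogonal to v and Jv, so D u maps the line of
  -- b 0 and b 1 to that of b 2 and b 3 and back. Two real numbers describe D u.
  have key (u : V) : ∃ p q : ℝ, D u (b 0) = p • b 2 + q • b 3 ∧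
      D u (b 2) = -p • b 0 - q • b 1 := by
    refine ⟨inner ℝ (b 2) (D u (b 0)), inner ℝ (b 3) (D u (b 0)), ?_, ?_⟩
    · conv_lhs => rw [← b.sum_repr' (D u (b 0))]
      have e1 := hself u (b 0)
      have e2 := hself' u (b 0)
      rw [h0] at e2
      simp [Fin.sum_univ_four, e1, e2]
    · conv_lhs => rw [← b.sum_repr' (D u (b 2))]
      have e1 := hself u (b 2)
      have e2 := hself' u (b 2)
      rw [h2] at e2
      have e3 : (inner ℝ (b 0) (D u (b 2)) : ℝ) = -inner ℝ (b 2) (D u (b 0)) := by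
        rw [real_inner_comm, hskew]
      have e4 : (inner ℝ (b 1) (D u (b 2)) : ℝ) = -inner ℝ (b 3) (D u (b 0)) := by
        rw [real_inner_comm, hskew, ← h0, hanti, inner_neg_right, neg_neg, ← h2,
          inner_map_eq_neg_inner_map hJ hJo, neg_neg]
      simp [Fin.sum_univ_four, e1, e2, e3, e4]
      module
  -- By `hint`, u = b 0 and u = b 2 suffice, so D depends on p, q, r, s alone.
  obtain ⟨p, q, d00, d02⟩ := key (b 0)
  obtain ⟨r, s, d20, d22⟩ := key (b 2)
  have d1 (v : V) : D (b 1) v = J (D (b 0) v) := by rw [← h0, hint]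
  have d3 (v : V) : D (b 3) v = J (D (b 2) v) := by rw [← h2, hint]
  have dv1 (u : V) : D u (b 1) = -J (D u (b 0)) := by rw [← h0, hanti]
  have dv3 (u : V) : D u (b 3) = -J (D u (b 2)) := by rw [← h2, hanti]
  have hTr (w : V) : (inner ℝ T w : ℝ) = -∑ i, inner ℝ (b i) (D (b i) (J w)) := by
    rw [hT, LinearMap.trace_eq_sum_inner _ b]
    simp
  -- Up to sign and the factor 2, the four parameters are the coordinates of T; hence the trace
  -- determines D.
  have hTe : T = (-2 * s) • b 0 + (2 * r) • b 1 + (2 * q) • b 2 + (-2 * p) • b 3 := by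
    rw [← b.sum_repr' T]
    have (i : Fin 4) : (inner ℝ (b i) T : ℝ) = inner ℝ T (b i) := real_inner_comm _ _
    simp only [this, hTr, Fin.sum_univ_four, h0, h1, h2, h3, map_neg, dv1, dv3, d1, d3, d00, d02,
      d20, d22, map_add, map_sub, map_smul, inner_add_right, inner_sub_right, inner_neg_right,
      inner_smul_right, hb]
    simp
    module
  have hlin (L L' : V →ₗ[ℝ] V →ₗ[ℝ] V) (h : ∀ i j, L (b i) (b j) = L' (b i) (b j)) : L = L' :=
    b.toBasis.ext fun i ↦ b.toBasis.ext fun j ↦ by simpa using h i j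
  have hJT : J T = (-2 * s) • b 1 - (2 * r) • b 0 + (2 * q) • b 3 + (2 * p) • b 2 := by
    rw [hTe]
    simp only [map_add, map_smul, h0, h1, h2, h3]
    module
  -- The right-hand side is packaged as a bilinear map, so that comparing values on the basis is
  -- enough.
  have := hlin ((2 : ℝ) • D)
    ((innerₗ V).compr₂ (LinearMap.toSpanSingleton ℝ V (J T))
      - (LinearMap.lsmul ℝ V).flip.compl₂ (innerₗ V (J T))
      + ((innerₗ V).comp J).compr₂ (LinearMap.toSpanSingleton ℝ V T)
      - ((LinearMap.lsmul ℝ V).flip.comp J).compl₂ (innerₗ V T)) ?_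
  · simpa using congr($this u v)
  · intro i j
    simp only [LinearMap.smul_apply, LinearMap.sub_apply, LinearMap.add_apply,
      LinearMap.compr₂_apply, LinearMap.compl₂_apply, LinearMap.flip_apply, LinearMap.comp_apply,
      LinearMap.toSpanSingleton_apply, LinearMap.lsmul_apply, innerₗ_apply_apply]
    rw [hJT, hTe]
    fin_cases i <;> fin_cases j <;>
    · simp only [Fin.mk_zero, Fin.mk_one, Fin.reduceFinMk, d1, d3, dv1, dv3, d00,
        d02, d20, d22, map_add, map_sub, map_smul, map_neg, h0, h1, h2, h3, inner_add_left,
        inner_sub_left, inner_neg_left, real_inner_smul_left, hb]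
      simp
      module

end LinearAlgebra

/-! ### Pointwise algebra: vanishing of the alternated second derivative of J -/

section LinearAlgebra

variable {V : Type*} [NormedAddCommGroup V] [InnerProductSpace ℝ V]

/-- The value of `⟨(∇_u J) v, z⟩` on a Hermitian surface whose Lee form is dual to `T`. -/
def covDerivForm (J : V →ₗ[ℝ] V) (T u v z : V) : ℝ :=
  2⁻¹ * (inner ℝ u v * inner ℝ (J T) z - inner ℝ (J T) v * inner ℝ u z
    + inner ℝ (J u) v * inner ℝ T z - inner ℝ T v * inner ℝ (J u) z)

/-- The value of `⟨(∇²_{u,v} J) w, z⟩` on a Hermitian surface whose Lee form is dual to `T`, with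
`B = ∇T`. -/
def secondCovDerivForm (J : V →ₗ[ℝ] V) (T : V) (B : V →ₗ[ℝ] V) (u v w z : V) : ℝ :=
  2⁻¹ * (inner ℝ v w * (covDerivForm J T u T z + inner ℝ (J (B u)) z)
    - (covDerivForm J T u T w + inner ℝ (J (B u)) w) * inner ℝ v z
    + covDerivForm J T u v w * inner ℝ T z + inner ℝ (J v) w * inner ℝ (B u) z
    - inner ℝ (B u) w * inner ℝ (J v) z - inner ℝ T w * covDerivForm J T u v z)

theorem eq_zero_of_skew {n : ℕ} (b : OrthonormalBasis (Fin n) ℝ V)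
    {f : V → V → ℝ} (hskew : ∀ x y, f x y = -f y x) (hadd : ∀ x y z, f x (y + z) = f x y + f x z)
    (hsmul : ∀ (c : ℝ) x y, f x (c • y) = c * f x y) (h : ∀ i j, i < j → f (b i) (b j) = 0)
    (v w : V) : f v w = 0 := by
  have h' (i j : Fin n) : f (b i) (b j) = 0 := by
    rcases lt_trichotomy i j with hij | rfl | hij
    · exact h i j hij
    · linarith [hskew (b i) (b i)]
    · rw [hskew, h j i hij, neg_zero]
  refine eq_zero_of_forall_orthonormalBasis b (f := f v) (hadd v) (fun c ↦ hsmul c v) (fun j ↦ ?_) w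
  rw [hskew, neg_eq_zero]
  exact eq_zero_of_forall_orthonormalBasis b (f := f (b j)) (hadd _) (fun c ↦ hsmul c _)
    (fun i ↦ h' _ _) v

/-- The difference `⟨(∇²_{u,v} J - ∇²_{v,u} J) w, z⟩` on a Hermitian surface. -/
def alternatedForm (J : V →ₗ[ℝ] V) (T : V) (B : V →ₗ[ℝ] V) (u v w z : V) : ℝ :=
  secondCovDerivForm J T B u v w z - secondCovDerivForm J T B v u w z

section

variable {J : V →ₗ[ℝ] V} (T : V) (B : V →ₗ[ℝ] V)

/-- The factor 4 clears the two factors 1/2, one from the formula for ∇J and one from its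
derivative. Terms with ⟨JT, T⟩ drop out because J is skew. -/
theorem alternatedForm_eq (hJ : ∀ v, J (J v) = -v)
    (hJo : ∀ v w, (inner ℝ (J v) (J w) : ℝ) = inner ℝ v w) (u v w z : V) :
    4 * alternatedForm J T B u v w z =
      inner ℝ v w * (-inner ℝ T u * inner ℝ T (J z) + inner ℝ T (J u) * inner ℝ T z
        - inner ℝ T T * inner ℝ (J u) z - 2 * inner ℝ (B u) (J z))
      - inner ℝ v z * (-inner ℝ T u * inner ℝ T (J w) + inner ℝ T (J u) * inner ℝ T w
        - inner ℝ T T * inner ℝ (J u) w - 2 * inner ℝ (B u) (J w))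
      - inner ℝ u w * (-inner ℝ T v * inner ℝ T (J z) + inner ℝ T (J v) * inner ℝ T z
        - inner ℝ T T * inner ℝ (J v) z - 2 * inner ℝ (B v) (J z))
      + inner ℝ u z * (-inner ℝ T v * inner ℝ T (J w) + inner ℝ T (J v) * inner ℝ T w
        - inner ℝ T T * inner ℝ (J v) w - 2 * inner ℝ (B v) (J w))
      + 2 * inner ℝ (J v) w * inner ℝ (B u) z - 2 * inner ℝ (B u) w * inner ℝ (J v) z
      - 2 * inner ℝ (J u) w * inner ℝ (B v) z + 2 * inner ℝ (B v) w * inner ℝ (J u) z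
      + (inner ℝ T (J v) * inner ℝ u w + inner ℝ (J u) v * inner ℝ T w
        - inner ℝ T v * inner ℝ (J u) w) * inner ℝ T z
      - (inner ℝ T (J u) * inner ℝ v w + inner ℝ (J v) u * inner ℝ T w
        - inner ℝ T u * inner ℝ (J v) w) * inner ℝ T z
      - inner ℝ T w * (inner ℝ T (J v) * inner ℝ u z + inner ℝ (J u) v * inner ℝ T z
        - inner ℝ T v * inner ℝ (J u) z)
      + inner ℝ T w * (inner ℝ T (J u) * inner ℝ v z + inner ℝ (J v) u * inner ℝ T z
        - inner ℝ T u * inner ℝ (J v) z) := by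
  have hJT : (inner ℝ (J T) T : ℝ) = 0 := inner_map_self_eq_zero hJ hJo T
  have e (x : V) : (inner ℝ x T : ℝ) = inner ℝ T x := real_inner_comm _ _
  have hJi (x y : V) : (inner ℝ (J x) y : ℝ) = -inner ℝ x (J y) :=
    inner_map_eq_neg_inner_map hJ hJo x y
  have e' : (inner ℝ u v : ℝ) = inner ℝ v u := real_inner_comm _ _
  simp only [alternatedForm, secondCovDerivForm, covDerivForm, hJT, e, e', hJi T, hJi (B _)]
  ring

theorem alternatedForm_swap_left (u v w z : V) :
    alternatedForm J T B u v w z = -alternatedForm J T B v u w z := by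
  simp only [alternatedForm]
  ring

theorem alternatedForm_swap_right (hJ : ∀ v, J (J v) = -v)
    (hJo : ∀ v w, (inner ℝ (J v) (J w) : ℝ) = inner ℝ v w) (u v w z : V) :
    alternatedForm J T B u v w z = -alternatedForm J T B u v z w := by
  have h1 := alternatedForm_eq T B hJ hJo u v w z
  have h2 := alternatedForm_eq T B hJ hJo u v z w
  linarith

/-- A commutator with J anticommutes with J, and J is skew, so this symmetry is expected of the
curvature term. For the algebraic expression it holds with arbitrary T and B. -/
theorem alternatedForm_map (hJ : ∀ v, J (J v) = -v)
    (hJo : ∀ v w, (inner ℝ (J v) (J w) : ℝ) = inner ℝ v w) (u v w z : V) :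
    alternatedForm J T B u v (J w) z = alternatedForm J T B u v w (J z) := by
  have h1 := alternatedForm_eq T B hJ hJo u v (J w) z
  have h2 := alternatedForm_eq T B hJ hJo u v w (J z)
  simp only [inner_map_eq_neg_inner_map hJ hJo, hJ, inner_neg_right] at h1 h2
  linarith

theorem alternatedForm_add_right (u v w x y : V) : alternatedForm J T B u v w (x + y) =
    alternatedForm J T B u v w x + alternatedForm J T B u v w y := by
  simp only [alternatedForm, secondCovDerivForm, covDerivForm, inner_add_right]
  ring

theorem alternatedForm_smul_right (u v w x : V) (c : ℝ) : alternatedForm J T B u v w (c • x) =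
    c * alternatedForm J T B u v w x := by
  simp only [alternatedForm, secondCovDerivForm, covDerivForm, inner_smul_right]
  ring

theorem alternatedForm_add_middle (u x y w z : V) : alternatedForm J T B u (x + y) w z =
    alternatedForm J T B u x w z + alternatedForm J T B u y w z := by
  simp only [alternatedForm, secondCovDerivForm, covDerivForm, inner_add_right, inner_add_left,
    map_add]
  ring

theorem alternatedForm_smul_middle (u x w z : V) (c : ℝ) : alternatedForm J T B u (c • x) w z =
    c * alternatedForm J T B u x w z := by
  simp only [alternatedForm, secondCovDerivForm, covDerivForm, inner_smul_right,
    real_inner_smul_left, map_smul]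
  ring

/-- In w, z the form is a J-anti-invariant 2-form. In dimension four these form a real plane, with
the values on (b 0, b 2) and (b 0, b 3) as coordinates. -/
theorem alternatedForm_eq_zero_of_basis (hJ : ∀ v, J (J v) = -v)
    (hJo : ∀ v w, (inner ℝ (J v) (J w) : ℝ) = inner ℝ v w) {b : OrthonormalBasis (Fin 4) ℝ V}
    (h0 : J (b 0) = b 1) (h2 : J (b 2) = b 3) (h3 : J (b 3) = -b 2)
    (h : ∀ i j, i < j → alternatedForm J T B (b i) (b j) (b 0) (b 2) = 0 ∧
      alternatedForm J T B (b i) (b j) (b 0) (b 3) = 0) (u v w z : V) :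
    alternatedForm J T B u v w z = 0 := by
  refine eq_zero_of_skew b (f := alternatedForm J T B u v)
    (alternatedForm_swap_right T B hJ hJo u v) (alternatedForm_add_right T B u v)
    (fun c x y ↦ alternatedForm_smul_right T B u v x y c) (fun k l hkl ↦ ?_) w z
  refine eq_zero_of_skew b (f := fun u v ↦ alternatedForm J T B u v (b k) (b l))
    (fun u v ↦ alternatedForm_swap_left T B u v _ _)
    (fun u x y ↦ alternatedForm_add_middle T B u x y _ _)
    (fun c u x ↦ alternatedForm_smul_middle T B u x _ _ c) (fun i j hij ↦ ?_) u v
  obtain ⟨e2, e3⟩ := h i j hij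
  have hs := alternatedForm_swap_right T B hJ hJo (b i) (b j)
  have hm := alternatedForm_map T B hJ hJo (b i) (b j)
  have hn (x y : V) : alternatedForm J T B (b i) (b j) x (-y) =
      -alternatedForm J T B (b i) (b j) x y := by
    rw [← neg_one_smul ℝ y, alternatedForm_smul_right, neg_one_mul]
  have f1 : alternatedForm J T B (b i) (b j) (b 0) (b 1) = 0 := by
    have := hm (b 0) (b 0)
    rw [h0] at this
    linarith [hs (b 0) (b 1)]
  have f2 : alternatedForm J T B (b i) (b j) (b 2) (b 3) = 0 := by
    have := hm (b 2) (b 2)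
    rw [h2] at this
    linarith [hs (b 2) (b 3)]
  have f3 : alternatedForm J T B (b i) (b j) (b 1) (b 2) = 0 := by
    rw [← h0, hm, h2, e3]
  have f4 : alternatedForm J T B (b i) (b j) (b 1) (b 3) = 0 := by
    rw [← h0, hm, h3, hn, e2, neg_zero]
  fin_cases k <;> fin_cases l <;> first | exact absurd hkl (by decide) | assumption

end

-- The algebraic core, to be applied with R the curvature tensor at a point, T the Lee field and B =
-- ∇T. Written in an adapted basis, both sides are systems of equations linear in the entries of B.
set_option maxHeartbeats 1000000 in
theorem forall_commutator_eq_zero_iff (hV : Module.finrank ℝ V = 4)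
    {J : V →ₗ[ℝ] V} (hJ : ∀ v, J (J v) = -v)
    (hJo : ∀ v w, (inner ℝ (J v) (J w) : ℝ) = inner ℝ v w) (T : V) (B : V →ₗ[ℝ] V)
    (R : V → V → V → V → ℝ) (hpair : ∀ u v w z, R u v w z = R w z u v)
    (hneg₃ : ∀ u v w z, R u v (-w) z = -R u v w z) (hneg₄ : ∀ u v w z, R u v w (-z) = -R u v w z)
    (hR : ∀ u v w z, R u v (J w) z + R u v w (J z) =
      alternatedForm J T B u v w z) :
    (∀ u v w z, R u v w z = R u v (J w) (J z)) ↔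
      2 * LinearMap.trace ℝ V B = ‖T‖ ^ 2 ∧
      ∀ v w, (inner ℝ (B v) w - inner ℝ (B (J v)) (J w)) / 2 =
        -(1 / 4) * ((inner ℝ T v * inner ℝ T w : ℝ) - inner ℝ T (J v) * inner ℝ T (J w)) := by
  -- Replacing w by Jw, or z by Jz, and using J² = -1 turns invariance into vanishing of the sum in
  -- `hR`.
  have hGray : (∀ u v w z, R u v w z = R u v (J w) (J z)) ↔
      ∀ u v w z, alternatedForm J T B u v w z = 0 := by
    simp only [← hR]
    constructor
    · intro h u v w z
      rw [h u v (J w) z, hJ, hneg₃, neg_add_cancel]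
    · intro h u v w z
      have := h u v w (J z)
      rw [hJ, hneg₄] at this
      linarith
  obtain ⟨b, h0, h1, h2, h3⟩ := exists_adapted_orthonormalBasis hV hJ hJo
  have hb (i j : Fin 4) : (inner ℝ (b i) (b j) : ℝ) = if i = j then 1 else 0 :=
    (orthonormal_iff_ite.1 b.orthonormal) i j
  have hJi (v w : V) : (inner ℝ (J v) w : ℝ) = -inner ℝ v (J w) :=
    inner_map_eq_neg_inner_map hJ hJo v w
  have hTT : (inner ℝ T T : ℝ) = inner ℝ T (b 0) ^ 2 + inner ℝ T (b 1) ^ 2 + inner ℝ T (b 2) ^ 2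
      + inner ℝ T (b 3) ^ 2 := by
    rw [real_inner_self_eq_norm_sq, ← b.sum_sq_inner_left T]
    simp [Fin.sum_univ_four]
  have htr : LinearMap.trace ℝ V B = inner ℝ (B (b 0)) (b 0) + inner ℝ (B (b 1)) (b 1)
      + inner ℝ (B (b 2)) (b 2) + inner ℝ (B (b 3)) (b 3) := by
    rw [LinearMap.trace_eq_sum_inner _ b]
    simp only [Fin.sum_univ_four, real_inner_comm]
  have hbT (i : Fin 4) : (inner ℝ (b i) T : ℝ) = inner ℝ T (b i) := real_inner_comm _ _
  -- In this combination the curvature terms cancel by pair symmetry. In terms of B, with B_ij = ⟨B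
  -- (b i), b j⟩, it equals B_01 - B_10 + B_23 - B_32, the ω-trace of dθ.
  have hω : alternatedForm J T B (b 0) (b 2) (b 0) (b 2) - alternatedForm J T B (b 1) (b 3) (b 0) (b 2)
      + alternatedForm J T B (b 0) (b 3) (b 0) (b 3) + alternatedForm J T B (b 1) (b 2) (b 0) (b 3)
      = 0 := by
    simp only [← hR, h0, h2, h3, hneg₄]
    linarith [hpair (b 0) (b 2) (b 1) (b 2), hpair (b 0) (b 2) (b 0) (b 3),
      hpair (b 1) (b 3) (b 1) (b 2), hpair (b 1) (b 3) (b 0) (b 3)]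
  have hA (i j k l : Fin 4) := alternatedForm_eq T B hJ hJo (b i) (b j) (b k) (b l)
  have e1 := hA 0 1 0 2
  have e2 := hA 0 1 0 3
  have e3 := hA 2 3 0 2
  have e4 := hA 2 3 0 3
  have e5 := hA 0 2 0 2
  have e6 := hA 0 2 0 3
  have e7 := hA 0 3 0 2
  have e8 := hA 0 3 0 3
  have e9 := hA 1 2 0 2
  have e10 := hA 1 2 0 3
  have e11 := hA 1 3 0 2
  have e12 := hA 1 3 0 3
  clear hA
  simp only [h0, h1, h2, h3, inner_neg_right, inner_neg_left, hb, hTT, Fin.reduceEq, if_true,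
    if_false] at e1 e2 e3 e4 e5 e6 e7 e8 e9 e10 e11 e12
  ring_nf at e1 e2 e3 e4 e5 e6 e7 e8 e9 e10 e11 e12
  rw [hGray, ← real_inner_self_eq_norm_sq, htr, hTT]
  constructor
  · intro h
    simp only [h, zero_mul] at e1 e2 e3 e4 e5 e6 e7 e8 e9 e10 e11 e12
    clear h hω hR hGray hpair hneg₃ hneg₄
    refine ⟨by linarith, fun v w ↦ sub_eq_zero.1 ?_⟩
    refine eq_zero_of_forall_orthonormalBasis b
      (f := fun v ↦ (inner ℝ (B v) w - inner ℝ (B (J v)) (J w)) / 2 -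
        -(1 / 4) * ((inner ℝ T v * inner ℝ T w : ℝ) - inner ℝ T (J v) * inner ℝ T (J w)))
      ?_ ?_ (fun i ↦ ?_) v
    · intro x y
      simp only [map_add, inner_add_left, inner_add_right]
      ring
    · intro c x
      simp only [map_smul, real_inner_smul_left, real_inner_smul_right]
      ring
    refine eq_zero_of_forall_orthonormalBasis b
      (f := fun w ↦ (inner ℝ (B (b i)) w - inner ℝ (B (J (b i))) (J w)) / 2 -
        -(1 / 4) * ((inner ℝ T (b i) * inner ℝ T w : ℝ) - inner ℝ T (J (b i)) * inner ℝ T (J w)))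
      ?_ ?_ (fun j ↦ ?_) w
    · intro x y
      simp only [map_add, inner_add_right]
      ring
    · intro c x
      simp only [map_smul, real_inner_smul_right]
      ring
    fin_cases i <;> fin_cases j <;>
    · simp only [Fin.mk_zero, Fin.mk_one, Fin.reduceFinMk, h0, h1, h2, h3, inner_neg_right,
        inner_neg_left, map_neg]
      linarith
  · rintro ⟨ht, hB⟩
    -- An anti-invariant tensor changes sign when J is applied to both arguments, so b 0 and b 2
    -- suffice in the first one.
    have a1 := hB (b 0) (b 0)
    have a2 := hB (b 0) (b 1)
    have a3 := hB (b 0) (b 2)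
    have a4 := hB (b 0) (b 3)
    have a5 := hB (b 2) (b 0)
    have a6 := hB (b 2) (b 1)
    have a7 := hB (b 2) (b 2)
    have a8 := hB (b 2) (b 3)
    clear hB hR hGray hpair hneg₃ hneg₄
    simp only [h0, h1, h2, h3, inner_neg_right] at a1 a2 a3 a4 a5 a6 a7 a8
    -- When u, v span a complex line, only the anti-invariant part of B enters. Of the other eight
    -- components, four also involve the trace of B (`ht`), and four the ω-trace of dθ (`hω`).
    have z1 : alternatedForm J T B (b 0) (b 1) (b 0) (b 2) = 0 := by
      linarith only [e1, a1, a2, a3, a4, a5, a6, a7, a8]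
    have z2 : alternatedForm J T B (b 0) (b 1) (b 0) (b 3) = 0 := by
      linarith only [e2, a1, a2, a3, a4, a5, a6, a7, a8]
    have z3 : alternatedForm J T B (b 2) (b 3) (b 0) (b 2) = 0 := by
      linarith only [e3, a1, a2, a3, a4, a5, a6, a7, a8]
    have z4 : alternatedForm J T B (b 2) (b 3) (b 0) (b 3) = 0 := by
      linarith only [e4, a1, a2, a3, a4, a5, a6, a7, a8]
    have z5 : alternatedForm J T B (b 0) (b 2) (b 0) (b 2) = 0 := by
      linarith only [e5, e8, e10, e11, hω, a1, a2, a3, a4, a5, a6, a7, a8]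
    have z6 : alternatedForm J T B (b 0) (b 2) (b 0) (b 3) = 0 := by
      linarith only [ht, e6, a1, a2, a3, a4, a5, a6, a7, a8]
    have z7 : alternatedForm J T B (b 0) (b 3) (b 0) (b 2) = 0 := by
      linarith only [ht, e7, a1, a2, a3, a4, a5, a6, a7, a8]
    have z8 : alternatedForm J T B (b 0) (b 3) (b 0) (b 3) = 0 := by
      linarith only [e5, e8, e10, e11, hω, a1, a2, a3, a4, a5, a6, a7, a8]
    have z9 : alternatedForm J T B (b 1) (b 2) (b 0) (b 2) = 0 := by
      linarith only [ht, e9, a1, a2, a3, a4, a5, a6, a7, a8]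
    have z10 : alternatedForm J T B (b 1) (b 2) (b 0) (b 3) = 0 := by
      linarith only [e5, e8, e10, e11, hω, a1, a2, a3, a4, a5, a6, a7, a8]
    have z11 : alternatedForm J T B (b 1) (b 3) (b 0) (b 2) = 0 := by
      linarith only [e5, e8, e10, e11, hω, a1, a2, a3, a4, a5, a6, a7, a8]
    have z12 : alternatedForm J T B (b 1) (b 3) (b 0) (b 3) = 0 := by
      linarith only [ht, e12, a1, a2, a3, a4, a5, a6, a7, a8]
    refine alternatedForm_eq_zero_of_basis T B hJ hJo h0 h2 h3 fun i j hij ↦ ?_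
    fin_cases i <;> fin_cases j <;> first | exact absurd hij (by decide) | constructor <;> assumption

end LinearAlgebra

/-! ### Coordinate vector fields: vanishing brackets and commuting derivatives -/

section CoordinateFields

open Filter Topology

variable {E : Type*} [NormedAddCommGroup E] [NormedSpace ℝ E]
  {H : Type*} [TopologicalSpace H] {I : ModelWithCorners ℝ E H}
  {M : Type*} [TopologicalSpace M] [ChartedSpace H M] [IsManifold I ∞ M]

/-- The constant value of the field `extend E v` in the chart around `x`. -/
def chartVector {x : M} (v : TangentSpace I x) : E :=
  (trivializationAt E (TangentSpace I) x ⟨x, v⟩).2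

theorem extend_eq_symmL {x y : M} (hy : y ∈ (chartAt H x).source) (v : TangentSpace I x) :
    extend E v y = (trivializationAt E (TangentSpace I) x).symmL ℝ y (chartVector v) := by
  rw [Trivialization.symmL_apply _ (by simpa using hy)]
  rfl

theorem mfderiv_extChartAt_extend {x y : M} (hy : y ∈ (chartAt H x).source)
    (v : TangentSpace I x) :
    mfderiv I 𝓘(ℝ, E) (extChartAt I x) y (extend E v y) = chartVector (E := E) v := by
  rw [extend_eq_symmL hy, ← TangentBundle.continuousLinearMapAt_trivializationAt hy]
  exact Trivialization.continuousLinearMapAt_symmL (R := ℝ)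
    (trivializationAt E (TangentSpace I) x) (by simpa using hy) (chartVector v)

variable (E) in
/-- The constant vector field on a normed space. -/
def constField (w : E) (e : E) : TangentSpace 𝓘(ℝ, E) e := w

theorem mdifferentiableAt_constField (w e : E) : MDiffAt (T% (constField E w)) e := by
  rw [mdifferentiableAt_section]
  simpa [constField] using mdifferentiableAt_const

theorem mlieBracket_constField (w w' : E) :
    mlieBracket 𝓘(ℝ, E) (constField E w) (constField E w') = 0 := by
  rw [← mlieBracketWithin_univ, mlieBracketWithin_eq_lieBracketWithin]
  refine lieBracketWithin_univ.trans ?_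
  funext e
  change fderiv ℝ (fun _ : E ↦ w') e w - fderiv ℝ (fun _ : E ↦ w) e w' = 0
  simp

theorem extend_eq_mpullback {x y : M} (hy : y ∈ (chartAt H x).source) (v : TangentSpace I x) :
    extend E v y = mpullback I 𝓘(ℝ, E) (extChartAt I x) (constField E (chartVector v)) y := by
  rw [mpullback_apply, eq_comm,
    (isInvertible_mfderiv_extChartAt (by simpa using hy)).inverse_apply_eq]
  exact (mfderiv_extChartAt_extend hy v).symm

theorem eventually_mem_chartAt_source (x : M) : ∀ᶠ y in 𝓝 x, y ∈ (chartAt H x).source :=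
  chart_source_mem_nhds H x

/-- On the chart domain these fields are pullbacks of constant fields on the model space, and
brackets commute with pullback. -/
theorem mlieBracket_extend_eq_zero [CompleteSpace E] {x y : M} (hy : y ∈ (chartAt H x).source)
    (u v : TangentSpace I x) : mlieBracket I (extend E u) (extend E v) y = 0 := by
  have : IsManifold I (minSmoothness ℝ 2) M := .of_le (n := ∞) (by simp; norm_cast)
  have h (w : TangentSpace I x) : (extend E w : Π z : M, TangentSpace I z) =ᶠ[𝓝 y]
      mpullback I 𝓘(ℝ, E) (extChartAt I x) (constField E (chartVector w)) := by
    filter_upwards [(chartAt H x).open_source.mem_nhds hy] with z hz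
    exact extend_eq_mpullback hz w
  rw [Filter.EventuallyEq.mlieBracket_vectorField_eq (h u) (h v),
    ← mpullback_mlieBracket (n := 2) (mdifferentiableAt_constField _ _)
      (mdifferentiableAt_constField _ _) (contMDiffAt_extChartAt' hy) (by simp),
    mpullback_apply, mlieBracket_constField]
  exact map_zero _

theorem eventually_mdifferentiableAt {x : M} {f : M → ℝ} (hf : CMDiffAt ∞ f x) :
    ∀ᶠ y in 𝓝 x, MDiffAt f y := by
  have h1 : CMDiffAt 1 f x := hf.of_le (by simp)
  filter_upwards [(contMDiffAt_iff_contMDiffAt_nhds (by simp)).1 h1] with y hy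
  exact hy.mdifferentiableAt one_ne_zero

section Boundaryless

variable [I.Boundaryless]

/-- The chain rule through the chart, whose differential makes the field constant. Iterated
derivatives thus become second derivatives of one function on `E`, which are symmetric. -/
theorem mvfderiv_extend {x y : M} (hy : y ∈ (chartAt H x).source) (v : TangentSpace I x)
    {f : M → ℝ} (hf : MDiffAt f y) :
    mvfderiv I f y (extend E v y) =
      fderiv ℝ (f ∘ (extChartAt I x).symm) (extChartAt I x y) (chartVector v) := by
  have hy' : y ∈ (extChartAt I x).source := by simpa using hy
  have hmem : (extChartAt I x).target ∈ 𝓝 (extChartAt I x y) :=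
    (isOpen_extChartAt_target x).mem_nhds ((extChartAt I x).map_source hy')
  have hs : MDifferentiableAt 𝓘(ℝ, E) I (extChartAt I x).symm (extChartAt I x y) :=
    ((contMDiffOn_extChartAt_symm (n := 1) x).contMDiffAt hmem).mdifferentiableAt one_ne_zero
  have hφ : MDifferentiableAt I 𝓘(ℝ, E) (extChartAt I x) y := mdifferentiableAt_extChartAt hy
  have hf' : MDifferentiableAt I 𝓘(ℝ, ℝ) f ((extChartAt I x).symm (extChartAt I x y)) := by
    rwa [(extChartAt I x).left_inv hy']
  have hcomp := hf'.comp _ hs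
  have heq : f =ᶠ[𝓝 y] (f ∘ (extChartAt I x).symm) ∘ extChartAt I x := by
    filter_upwards [(chartAt H x).open_source.mem_nhds hy] with z hz
    exact congrArg f ((extChartAt I x).left_inv (by simpa using hz)).symm
  have h1 : mvfderiv I f y = mvfderiv I ((f ∘ (extChartAt I x).symm) ∘ extChartAt I x) y := by
    have := heq.mfderiv_eq (I := I) (I' := 𝓘(ℝ, ℝ))
    ext w
    exact congr($this w)
  rw [h1, mvfderiv_comp _ hcomp hφ, ContinuousLinearMap.comp_apply,
    mfderiv_extChartAt_extend hy]
  exact congr($(mfderiv_eq_fderiv) _)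

theorem contDiffAt_comp_extChartAt_symm {x : M} {f : M → ℝ} (hf : CMDiffAt ∞ f x) :
    ContDiffAt ℝ ∞ (f ∘ (extChartAt I x).symm) (extChartAt I x x) := by
  rw [← contMDiffAt_iff_contDiffAt]
  have hf' : CMDiffAt ∞ f ((extChartAt I x).symm (extChartAt I x x)) := by simpa using hf
  refine ContMDiffAt.comp (I' := I) (extChartAt I x x) hf' ?_
  exact (contMDiffOn_extChartAt_symm x).contMDiffAt (extChartAt_target_mem_nhds x)

theorem eventually_mvfderiv_extend {x : M} (v : TangentSpace I x) {f : M → ℝ}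
    (hf : CMDiffAt ∞ f x) :
    (fun y ↦ mvfderiv I f y (extend E v y)) =ᶠ[𝓝 x]
      (fun e ↦ fderiv ℝ (f ∘ (extChartAt I x).symm) e (chartVector v)) ∘ extChartAt I x := by
  filter_upwards [eventually_mem_chartAt_source (H := H) x, eventually_mdifferentiableAt hf] with y hy hfy
  exact mvfderiv_extend hy v hfy

theorem contMDiffAt_mvfderiv_extend {x : M} (v : TangentSpace I x) {f : M → ℝ}
    (hf : CMDiffAt ∞ f x) : CMDiffAt ∞ (fun y ↦ mvfderiv I f y (extend E v y)) x := by
  refine ContMDiffAt.congr_of_eventuallyEq ?_ (eventually_mvfderiv_extend v hf)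
  refine ContMDiffAt.comp (I' := 𝓘(ℝ, E)) x ?_ contMDiffAt_extChartAt
  rw [contMDiffAt_iff_contDiffAt]
  exact ((contDiffAt_comp_extChartAt_symm hf).fderiv_right (m := ∞) (by simp)).clm_apply contDiffAt_const

theorem mvfderiv_mvfderiv_extend {x : M} (u v : TangentSpace I x) {f : M → ℝ}
    (hf : CMDiffAt ∞ f x) :
    mvfderiv I (fun y ↦ mvfderiv I f y (extend E v y)) x u =
      fderiv ℝ (fderiv ℝ (f ∘ (extChartAt I x).symm)) (extChartAt I x x) (chartVector u)
        (chartVector v) := by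
  have h := contDiffAt_comp_extChartAt_symm hf
  have hd : DifferentiableAt ℝ (fderiv ℝ (f ∘ (extChartAt I x).symm)) (extChartAt I x x) :=
    (h.fderiv_right (m := 1) (by norm_cast)).differentiableAt one_ne_zero
  have := mvfderiv_extend (mem_chart_source H x) u
    ((contMDiffAt_mvfderiv_extend v hf).mdifferentiableAt (by simp))
  rw [extend_apply_self] at this
  rw [this]
  have heq : (fun y ↦ mvfderiv I f y (extend E v y)) ∘ (extChartAt I x).symm
      =ᶠ[𝓝 (extChartAt I x x)]
        fun e ↦ fderiv ℝ (f ∘ (extChartAt I x).symm) e (chartVector v) := by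
    have hc : Tendsto (extChartAt I x).symm (𝓝 (extChartAt I x x)) (𝓝 x) := by
      simpa using (continuousAt_extChartAt_symm (I := I) x).tendsto
    filter_upwards [hc.eventually (eventually_mvfderiv_extend v hf),
      extChartAt_target_mem_nhds (I := I) x] with e he het
    rw [Function.comp_apply, he, Function.comp_apply, (extChartAt I x).right_inv het]
  rw [heq.fderiv_eq, fderiv_clm_apply hd (differentiableAt_const _)]
  simp

/-- Derivatives along coordinate fields commute. -/
theorem mvfderiv_mvfderiv_extend_comm {x : M} (u v : TangentSpace I x) {f : M → ℝ}
    (hf : CMDiffAt ∞ f x) :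
    mvfderiv I (fun y ↦ mvfderiv I f y (extend E v y)) x u =
      mvfderiv I (fun y ↦ mvfderiv I f y (extend E u y)) x v := by
  rw [mvfderiv_mvfderiv_extend u v hf, mvfderiv_mvfderiv_extend v u hf]
  exact ((contDiffAt_comp_extChartAt_symm hf).isSymmSndFDerivAt (by simp; norm_cast)) _ _

end Boundaryless

end CoordinateFields

/-! ### Smoothness of covariant derivatives -/

section Smoothness

open Filter Topology

variable {E : Type*} [NormedAddCommGroup E] [NormedSpace ℝ E]
  {H : Type*} [TopologicalSpace H] {I : ModelWithCorners ℝ E H}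
  {M : Type*} [TopologicalSpace M] [ChartedSpace H M]

theorem contMDiffAt_det {n : Type*} [Fintype n] [DecidableEq n] {A : M → Matrix n n ℝ} {x : M}
    (h : ∀ i j, CMDiffAt ∞ (fun y ↦ A y i j) x) : CMDiffAt ∞ (fun y ↦ (A y).det) x := by
  simp only [Matrix.det_apply']
  exact ContMDiffAt.sum fun σ _ ↦ contMDiffAt_const.mul (ContMDiffAt.prod fun i _ ↦ h _ _)

variable [IsManifold I ∞ M]

theorem contMDiffAt_extend_tangent {x : M} (v : TangentSpace I x) :
    CMDiffAt ∞ (T% (extend E v : Π y : M, TangentSpace I y)) x :=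
  contMDiffAt_extend I E v

theorem eventually_mdifferentiableAt_section {x : M} {Z : Π y : M, TangentSpace I y}
    (hZ : CMDiffAt ∞ (T% Z) x) : ∀ᶠ y in 𝓝 x, MDiffAt (T% Z) y := by
  have h1 : CMDiffAt 1 (T% Z) x := hZ.of_le (by simp)
  filter_upwards [(contMDiffAt_iff_contMDiffAt_nhds (by simp)).1 h1] with y hy
  exact hy.mdifferentiableAt one_ne_zero

theorem eventually_mdifferentiableAt_extend {x : M} (v : TangentSpace I x) :
    ∀ᶠ y in 𝓝 x, MDiffAt (T% (extend E v : Π y : M, TangentSpace I y)) y :=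
  eventually_mdifferentiableAt_section (contMDiffAt_extend_tangent v)

variable (I) in
/-- The value at `x` of the `i`-th field of the frame given by the chart around `x`. -/
def frameVector {ι : Type*} (b : Module.Basis ι ℝ E) (x : M) (i : ι) : TangentSpace I x :=
  (trivializationAt E (TangentSpace I) x).localFrame b i x

theorem localFrame_eq_extend {ι : Type*} (b : Module.Basis ι ℝ E) {x y : M}
    (hy : y ∈ (chartAt H x).source) (i : ι) :
    (trivializationAt E (TangentSpace I) x).localFrame b i y = extend E (frameVector I b x i) y := by
  have hx := FiberBundle.mem_baseSet_trivializationAt E (TangentSpace I) x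
  rw [extend_eq_symmL hy, Trivialization.symmL_apply _ (by simpa using hy), frameVector,
    chartVector, Trivialization.localFrame_apply_of_mem_baseSet _ _ (by simpa using hy),
    Trivialization.localFrame_apply_of_mem_baseSet _ _ hx]
  simp [Trivialization.basisAt, Trivialization.apply_mk_symm _ hx]

variable [RiemannianBundle (fun x : M ↦ TangentSpace I x)]

theorem koszul_extend [CompleteSpace E] {x y : M} (hy : y ∈ (chartAt H x).source) (u v w : TangentSpace I x) :
    koszul I (extend E v) (extend E u) (extend E w) y =
      mvfderiv I (fun y ↦ inner ℝ (extend E v y) (extend E w y)) y (extend E u y)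
      + mvfderiv I (fun y ↦ inner ℝ (extend E w y) (extend E u y)) y (extend E v y)
      - mvfderiv I (fun y ↦ inner ℝ (extend E u y) (extend E v y)) y (extend E w y) := by
  simp [koszul, mlieBracket_extend_eq_zero hy]

variable [IsContMDiffRiemannianBundle I ∞ E (fun x : M ↦ TangentSpace I x)]

theorem contMDiffAt_inner {x : M} {Y Z : Π y : M, TangentSpace I y}
    (hY : CMDiffAt ∞ (T% Y) x) (hZ : CMDiffAt ∞ (T% Z) x) :
    CMDiffAt ∞ (fun y ↦ (inner ℝ (Y y) (Z y) : ℝ)) x :=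
  ContMDiffAt.inner_bundle (E := fun x : M ↦ TangentSpace I x) (F := E) (b := fun y ↦ y)
    (IB := I) hY hZ

variable [FiniteDimensional ℝ E]

/-- A vector field is smooth as soon as its inner products with coordinate fields are. -/
theorem contMDiffAt_of_inner_extend {x : M} {Z : Π y : M, TangentSpace I y}
    (h : ∀ v : TangentSpace I x, CMDiffAt ∞ (fun y ↦ (inner ℝ (Z y) (extend E v y) : ℝ)) x) :
    CMDiffAt ∞ (T% Z) x := by
  classical
  set t := trivializationAt E (TangentSpace I) x with ht
  have hx : x ∈ t.baseSet := FiberBundle.mem_baseSet_trivializationAt E (TangentSpace I) x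
  let b := Module.finBasis ℝ E
  have hframe (i) : CMDiffAt ∞ (T% (t.localFrame b i)) x := contMDiffAt_localFrame_of_mem _ _ b i hx
  let G (y : M) : Matrix _ _ ℝ := Matrix.gram ℝ (fun i ↦ t.localFrame b i y)
  have hG (i j) : CMDiffAt ∞ (fun y ↦ G y i j) x := contMDiffAt_inner (hframe i) (hframe j)
  let r (y : M) (i) : ℝ := inner ℝ (Z y) (t.localFrame b i y)
  have hr (i) : CMDiffAt ∞ (fun y ↦ r y i) x := by
    refine (h (frameVector I b x i)).congr_of_eventuallyEq ?_
    filter_upwards [eventually_mem_chartAt_source (H := H) x] with y hy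
    rw [← localFrame_eq_extend b hy]
  have hdet {y : M} (hy : y ∈ t.baseSet) : (G y).det ≠ 0 := by
    refine (Matrix.posDef_gram_of_linearIndependent ?_).det_pos.ne'
    exact (t.isLocalFrameOn_localFrame_baseSet I 1 b).linearIndependent hy
  -- The frame coefficients solve a linear system with the invertible Gram matrix; Cramer's rule
  -- writes them as quotients of smooth determinants.
  rw [contMDiffAt_iff_localFrameCoeff b hx]
  intro i
  have key : CMDiffAt ∞ (fun y ↦ ((G y).det)⁻¹ * ((G y).updateCol i (r y)).det) x := by
    refine ContMDiffAt.mul ((contMDiffAt_det hG).inv₀ (hdet hx)) (contMDiffAt_det fun k l ↦ ?_)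
    by_cases hl : l = i
    · subst hl
      simpa using hr k
    · simpa [Matrix.updateCol_apply, hl] using hG k l
  refine key.congr_of_eventuallyEq ?_
  filter_upwards [t.open_baseSet.mem_nhds hx] with y hy
  have hc : (G y).mulVec (fun i ↦ t.localFrameCoeff I b i y (Z y)) = r y := by
    ext k
    have hZ := Trivialization.eq_sum_localFrameCoeff_smul (I := I) (s := Z) (b := b) hy
    refine Eq.trans ?_ (congrArg (fun z ↦ (inner ℝ z (t.localFrame b k y) : ℝ)) hZ.symm)
    simp only [sum_inner, real_inner_smul_left, Matrix.mulVec, dotProduct, G, Matrix.gram_apply]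
    exact Finset.sum_congr rfl fun j _ ↦ by rw [real_inner_comm, mul_comm]
  rw [← hc, ← Matrix.cramer_apply, Matrix.cramer_eq_adjugate_mulVec, Matrix.mulVec_mulVec,
    Matrix.adjugate_mul]
  simp [hdet hy, Matrix.smul_mulVec]

theorem inner_leviCivita {Y X Z : Π x : M, TangentSpace I x} {x : M} (hY : MDiffAt (T% Y) x)
    (hX : MDiffAt (T% X) x) (hZ : MDiffAt (T% Z) x) :
    inner ℝ (leviCivita I M Y x (X x)) (Z x) = 2⁻¹ * koszul I Y X Z x :=
  inner_leviCivitaFun hY hX hZ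

variable [I.Boundaryless]

/-- For coordinate fields the bracket terms of the Koszul formula vanish, leaving derivatives of
metric coefficients, as for Christoffel symbols. -/
theorem contMDiffAt_leviCivita_extend_extend {x : M} (u v : TangentSpace I x) :
    CMDiffAt ∞ (T% (fun y ↦ leviCivita I M (extend E v) y (extend E u y))) x := by
  refine contMDiffAt_of_inner_extend fun w ↦ ?_
  have hs (v : TangentSpace I x) := contMDiffAt_extend_tangent v
  have h := ((contMDiffAt_mvfderiv_extend u (contMDiffAt_inner (hs v) (hs w))).add
    (contMDiffAt_mvfderiv_extend v (contMDiffAt_inner (hs w) (hs u)))).sub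
    (contMDiffAt_mvfderiv_extend w (contMDiffAt_inner (hs u) (hs v)))
  refine (contMDiffAt_const (c := (2⁻¹ : ℝ)).mul h).congr_of_eventuallyEq ?_
  filter_upwards [eventually_mem_chartAt_source (H := H) x, eventually_mdifferentiableAt_extend u,
    eventually_mdifferentiableAt_extend v, eventually_mdifferentiableAt_extend w]
    with y hy hu hv hw
  rw [inner_leviCivita hv hu hw, koszul_extend hy]
  rfl

/-- The covariant derivative of a smooth vector field along a coordinate field is smooth. -/
theorem contMDiffAt_leviCivita_extend {x : M} (u : TangentSpace I x)
    {Z : Π y : M, TangentSpace I y} (hZ : CMDiffAt ∞ (T% Z) x) :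
    CMDiffAt ∞ (T% (fun y ↦ leviCivita I M Z y (extend E u y))) x := by
  refine contMDiffAt_of_inner_extend fun w ↦ ?_
  have hw := contMDiffAt_extend_tangent w
  -- Metric compatibility, ⟨∇_U Z, W⟩ = U⟨Z, W⟩ - ⟨Z, ∇_U W⟩, moves the derivative onto a coordinate
  -- field.
  refine ((contMDiffAt_mvfderiv_extend u (contMDiffAt_inner hZ hw)).sub
    (contMDiffAt_inner hZ (contMDiffAt_leviCivita_extend_extend u w))).congr_of_eventuallyEq ?_
  filter_upwards [eventually_mdifferentiableAt_extend u, eventually_mdifferentiableAt_section hZ,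
    eventually_mdifferentiableAt_extend w] with y hu hZ hw
  have := mvfderiv_inner_eq hu hZ hw
  exact eq_sub_of_add_eq this.symm

end Smoothness

/-! ### Symmetries of the curvature tensor -/

section Curvature

open Filter Topology

variable {E : Type*} [NormedAddCommGroup E] [NormedSpace ℝ E]
  {H : Type*} [TopologicalSpace H] {I : ModelWithCorners ℝ E H}
  {M : Type*} [TopologicalSpace M] [ChartedSpace H M]

theorem mvfderiv_congr_of_eventuallyEq {f g : M → ℝ} {x : M} (h : f =ᶠ[𝓝 x] g) :
    mvfderiv I f x = mvfderiv I g x := by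
  have := h.mfderiv_eq (I := I) (I' := 𝓘(ℝ, ℝ))
  ext w
  exact congr($this w)

variable [IsManifold I ∞ M] [FiniteDimensional ℝ E]
  [RiemannianBundle (fun x : M ↦ TangentSpace I x)]
  [IsContMDiffRiemannianBundle I ∞ E (fun x : M ↦ TangentSpace I x)]

theorem leviCivita_add {x : M} {Y Z : Π y : M, TangentSpace I y} (hY : MDiffAt (T% Y) x)
    (hZ : MDiffAt (T% Z) x) (u : TangentSpace I x) :
    leviCivita I M (fun y ↦ Y y + Z y) x u = leviCivita I M Y x u + leviCivita I M Z x u := by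
  have := (leviCivita I M).isCovariantDerivativeOnUniv.add hY hZ
  exact congr($this u)

theorem leviCivita_smul {x : M} {f : M → ℝ} {Y : Π y : M, TangentSpace I y} (hf : MDiffAt f x)
    (hY : MDiffAt (T% Y) x) (u : TangentSpace I x) :
    leviCivita I M (fun y ↦ f y • Y y) x u = f x • leviCivita I M Y x u + mvfderiv I f x u • Y x := by
  have := (leviCivita I M).isCovariantDerivativeOnUniv.leibniz hY hf
  exact congr($this u)

theorem leviCivita_const_smul {x : M} (c : ℝ) {Y : Π y : M, TangentSpace I y}
    (hY : MDiffAt (T% Y) x) (u : TangentSpace I x) :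
    leviCivita I M (fun y ↦ c • Y y) x u = c • leviCivita I M Y x u := by
  have := (leviCivita I M).isCovariantDerivativeOnUniv.smul_const c hY
  exact congr($this u)

theorem leviCivita_neg {x : M} {Y : Π y : M, TangentSpace I y} (hY : MDiffAt (T% Y) x)
    (u : TangentSpace I x) : leviCivita I M (fun y ↦ -Y y) x u = -leviCivita I M Y x u := by
  simpa only [neg_smul, one_smul] using leviCivita_const_smul (-1) hY u

theorem leviCivita_sub {x : M} {Y Z : Π y : M, TangentSpace I y} (hY : MDiffAt (T% Y) x)
    (hZ : MDiffAt (T% Z) x) (u : TangentSpace I x) :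
    leviCivita I M (fun y ↦ Y y - Z y) x u = leviCivita I M Y x u - leviCivita I M Z x u := by
  simp only [sub_eq_add_neg]
  exact (leviCivita_add hY (mdifferentiableAt_neg_section hZ) u).trans
    (congrArg _ (leviCivita_neg hZ u))

theorem leviCivita_congr {x : M} {Y Z : Π y : M, TangentSpace I y} (hY : MDiffAt (T% Y) x)
    (hZ : MDiffAt (T% Z) x) (h : Y =ᶠ[𝓝 x] Z) : leviCivita I M Y x = leviCivita I M Z x :=
  (leviCivita I M).isCovariantDerivativeOnUniv.congr_of_eventuallyEq hY hZ univ_mem h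

theorem mvfderiv_inner {x : M} (u : TangentSpace I x) {Y Z : Π y : M, TangentSpace I y}
    (hY : MDiffAt (T% Y) x) (hZ : MDiffAt (T% Z) x) :
    mvfderiv I (fun y ↦ (inner ℝ (Y y) (Z y) : ℝ)) x u =
      inner ℝ (leviCivita I M Y x u) (Z x) + inner ℝ (Y x) (leviCivita I M Z x u) := by
  have := mvfderiv_inner_eq (mdifferentiableAt_extend I E u) hY hZ
  rwa [extend_apply_self] at this

theorem curvature_extend {x : M} (u v : TangentSpace I x) (Z : Π y : M, TangentSpace I y) :
    curvature (extend E u) (extend E v) Z x =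
      leviCivita I M (fun y ↦ leviCivita I M Z y (extend E v y)) x u
        - leviCivita I M (fun y ↦ leviCivita I M Z y (extend E u y)) x v := by
  simp [curvature, mlieBracket_extend_eq_zero (mem_chart_source H x)]

theorem curvature_extend_swap {x : M} (u v : TangentSpace I x) (Z : Π y : M, TangentSpace I y) :
    curvature (extend E u) (extend E v) Z x = -curvature (extend E v) (extend E u) Z x := by
  rw [curvature_extend, curvature_extend, neg_sub]

theorem eventually_leviCivita_extend_comm {x : M} (u v : TangentSpace I x) :
    (fun y ↦ leviCivita I M (extend E u) y (extend E v y)) =ᶠ[𝓝 x]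
      fun y ↦ leviCivita I M (extend E v) y (extend E u y) := by
  filter_upwards [eventually_mem_chartAt_source (H := H) x, eventually_mdifferentiableAt_extend u,
    eventually_mdifferentiableAt_extend v] with y hy hu hv
  have := leviCivita_sub_swap hu hv
  rw [mlieBracket_extend_eq_zero hy] at this
  exact (sub_eq_zero.1 this).symm

theorem riemann_swap_left {x : M} (u v w z : TangentSpace I x) :
    riemann x u v w z = -riemann x v u w z := by
  rw [riemann, riemann, curvature_extend_swap, inner_neg_left]

theorem riemann_neg_right {x : M} (u v w z : TangentSpace I x) :
    riemann x u v w (-z) = -riemann x u v w z := by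
  rw [riemann, riemann, inner_neg_right]

variable [I.Boundaryless]

theorem mdifferentiableAt_leviCivita_extend {x : M} (u : TangentSpace I x)
    {Z : Π y : M, TangentSpace I y} (hZ : CMDiffAt ∞ (T% Z) x) :
    MDiffAt (T% (fun y ↦ leviCivita I M Z y (extend E u y))) x :=
  (contMDiffAt_leviCivita_extend u hZ).mdifferentiableAt (by simp)

theorem mvfderiv_mvfderiv_inner {x : M} (u v : TangentSpace I x)
    {Y Z : Π y : M, TangentSpace I y} (hY : CMDiffAt ∞ (T% Y) x) (hZ : CMDiffAt ∞ (T% Z) x) :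
    mvfderiv I (fun y ↦ mvfderiv I (fun y ↦ (inner ℝ (Y y) (Z y) : ℝ)) y (extend E v y)) x u =
      inner ℝ (leviCivita I M (fun y ↦ leviCivita I M Y y (extend E v y)) x u) (Z x)
      + inner ℝ (leviCivita I M Y x v) (leviCivita I M Z x u)
      + (inner ℝ (leviCivita I M Y x u) (leviCivita I M Z x v)
        + inner ℝ (Y x) (leviCivita I M (fun y ↦ leviCivita I M Z y (extend E v y)) x u)) := by
  have h : (fun y ↦ mvfderiv I (fun y ↦ (inner ℝ (Y y) (Z y) : ℝ)) y (extend E v y)) =ᶠ[𝓝 x]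
      fun y ↦ inner ℝ (leviCivita I M Y y (extend E v y)) (Z y)
        + inner ℝ (Y y) (leviCivita I M Z y (extend E v y)) := by
    filter_upwards [eventually_mdifferentiableAt_section hY,
      eventually_mdifferentiableAt_section hZ] with y hY hZ
    exact mvfderiv_inner _ hY hZ
  have hY1 := hY.mdifferentiableAt (by simp)
  have hZ1 := hZ.mdifferentiableAt (by simp)
  have hY2 := mdifferentiableAt_leviCivita_extend v hY
  have hZ2 := mdifferentiableAt_leviCivita_extend v hZ
  rw [mvfderiv_congr_of_eventuallyEq h, mvfderiv_fun_add (mdifferentiableAt_inner hY2 hZ1)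
    (mdifferentiableAt_inner hY1 hZ2), add_apply, mvfderiv_inner u hY2 hZ1,
    mvfderiv_inner u hY1 hZ2]
  simp only [extend_apply_self]

/-- The curvature operators are skew-symmetric. -/
theorem inner_curvature_extend {x : M} (u v : TangentSpace I x)
    {Y Z : Π y : M, TangentSpace I y} (hY : CMDiffAt ∞ (T% Y) x) (hZ : CMDiffAt ∞ (T% Z) x) :
    (inner ℝ (curvature (extend E u) (extend E v) Y x) (Z x) : ℝ) =
      -inner ℝ (Y x) (curvature (extend E u) (extend E v) Z x) := by
  -- Expanding both second derivatives of ⟨Y, Z⟩, the mixed terms agree and the rest is the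
  -- skewness.
  have h := mvfderiv_mvfderiv_extend_comm u v (contMDiffAt_inner hY hZ)
  rw [mvfderiv_mvfderiv_inner u v hY hZ, mvfderiv_mvfderiv_inner v u hY hZ] at h
  rw [curvature_extend, curvature_extend, inner_sub_left, inner_sub_right]
  linarith

/-- Skewness moves the curvature operator onto a test field, after which only the values at x
matter; this gives tensoriality without a Leibniz computation. -/
theorem curvature_extend_congr {x : M} (u v : TangentSpace I x)
    {Y Z : Π y : M, TangentSpace I y} (hY : CMDiffAt ∞ (T% Y) x) (hZ : CMDiffAt ∞ (T% Z) x)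
    (h : Y x = Z x) :
    curvature (extend E u) (extend E v) Y x = curvature (extend E u) (extend E v) Z x := by
  refine ext_inner_right ℝ fun w ↦ ?_
  have hw := contMDiffAt_extend_tangent w
  have h1 := inner_curvature_extend u v hY hw
  have h2 := inner_curvature_extend u v hZ hw
  rw [extend_apply_self] at h1 h2
  rw [h1, h2, h]

theorem riemann_eq_inner_curvature {x : M} (u v z : TangentSpace I x)
    {W : Π y : M, TangentSpace I y} (hW : CMDiffAt ∞ (T% W) x) :
    riemann x u v (W x) z = inner ℝ (curvature (extend E u) (extend E v) W x) z := by
  rw [riemann, curvature_extend_congr u v (contMDiffAt_extend_tangent (W x)) hW (by simp)]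

theorem riemann_swap_right {x : M} (u v w z : TangentSpace I x) :
    riemann x u v w z = -riemann x u v z w := by
  have := inner_curvature_extend u v (contMDiffAt_extend_tangent w) (contMDiffAt_extend_tangent z)
  rw [extend_apply_self, extend_apply_self] at this
  rw [riemann, riemann, this, real_inner_comm]

/-- The first Bianchi identity. -/
theorem riemann_cyclic {x : M} (u v w z : TangentSpace I x) :
    riemann x u v w z + riemann x v w u z + riemann x w u v z = 0 := by
  have h (u v : TangentSpace I x) :
      leviCivita I M (fun y ↦ leviCivita I M (extend E u) y (extend E v y)) x =
        leviCivita I M (fun y ↦ leviCivita I M (extend E v) y (extend E u y)) x :=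
    leviCivita_congr (mdifferentiableAt_leviCivita_extend v (contMDiffAt_extend_tangent u))
      (mdifferentiableAt_leviCivita_extend u (contMDiffAt_extend_tangent v))
      (eventually_leviCivita_extend_comm u v)
  simp only [riemann, curvature_extend, inner_sub_left]
  rw [h u v, h v w, h w u]
  ring

/-- The usual argument: four instances of the first Bianchi identity combined with skewness in each
pair. -/
theorem riemann_pair_symm {x : M} (u v w z : TangentSpace I x) :
    riemann x u v w z = riemann x w z u v := by
  linarith [riemann_cyclic u v w z, riemann_cyclic v w z u, riemann_cyclic w z u v,
    riemann_cyclic z u v w, riemann_swap_left u v w z, riemann_swap_left v w u z,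
    riemann_swap_left w u v z, riemann_swap_right u v w z, riemann_swap_right v w u z,
    riemann_swap_right w u v z, riemann_swap_left v w z u, riemann_swap_left w z v u,
    riemann_swap_left z v w u, riemann_swap_right v w z u, riemann_swap_right w z v u,
    riemann_swap_right z v w u, riemann_swap_left w z u v, riemann_swap_left z u w v,
    riemann_swap_left u w z v, riemann_swap_right w z u v, riemann_swap_right z u w v,
    riemann_swap_right u w z v, riemann_swap_left z u v w, riemann_swap_left u v z w,
    riemann_swap_left v z u w, riemann_swap_right z u v w, riemann_swap_right u v z w,
    riemann_swap_right v z u w]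

theorem riemann_neg_middle {x : M} (u v w z : TangentSpace I x) :
    riemann x u v (-w) z = -riemann x u v w z := by
  rw [riemann_swap_right, riemann_neg_right, riemann_swap_right u v z w, neg_neg]

end Curvature

/-! ### The covariant derivative of J and integrability -/

section AlmostComplex

open Filter Topology

variable {E : Type*} [NormedAddCommGroup E] [NormedSpace ℝ E]
  {H : Type*} [TopologicalSpace H] {I : ModelWithCorners ℝ E H}
  {M : Type*} [TopologicalSpace M] [ChartedSpace H M] [IsManifold I ∞ M]
  [RiemannianBundle (fun x : M ↦ TangentSpace I x)]
  {J : Π x : M, TangentSpace I x →L[ℝ] TangentSpace I x}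

theorem IsHermitian.inner_map_left (hJ : IsHermitian J) (x : M) (v w : TangentSpace I x) :
    (inner ℝ (J x v) w : ℝ) = -inner ℝ v (J x w) := by
  rw [← hJ.orthogonal x v (J x w), hJ.sq, inner_neg_right, neg_neg]

theorem IsHermitian.contMDiffAt_map (hJ : IsHermitian J) {x : M} {Z : Π y : M, TangentSpace I y}
    (hZ : CMDiffAt ∞ (T% Z) x) : CMDiffAt ∞ (T% (fun y ↦ J y (Z y))) x :=
  ContMDiffAt.clm_bundle_apply (E₁ := fun x : M ↦ TangentSpace I x)
    (E₂ := fun x : M ↦ TangentSpace I x) (F₁ := E) (F₂ := E) (b := fun y ↦ y) (hJ.contMDiff x) hZ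

theorem IsHermitian.mdifferentiableAt_map (hJ : IsHermitian J) {x : M}
    {Z : Π y : M, TangentSpace I y} (hZ : MDiffAt (T% Z) x) :
    MDiffAt (T% (fun y ↦ J y (Z y))) x :=
  MDifferentiableAt.clm_bundle_apply (E₁ := fun x : M ↦ TangentSpace I x)
    (E₂ := fun x : M ↦ TangentSpace I x) (F₁ := E) (F₂ := E) (b := fun y ↦ y)
    ((hJ.contMDiff x).mdifferentiableAt (by simp)) hZ

variable [FiniteDimensional ℝ E]
  [IsContMDiffRiemannianBundle I ∞ E (fun x : M ↦ TangentSpace I x)]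

/-- Differentiate ⟨JV, W⟩ = -⟨V, JW⟩. Stated for arbitrary fields, the identity also shows that (∇_u
J)V depends only on the value of V at x. -/
theorem IsHermitian.inner_leviCivita_map_sub (hJ : IsHermitian J) {x : M} (u : TangentSpace I x)
    {V W : Π y : M, TangentSpace I y} (hV : MDiffAt (T% V) x) (hW : MDiffAt (T% W) x) :
    (inner ℝ (leviCivita I M (fun y ↦ J y (V y)) x u - J x (leviCivita I M V x u)) (W x) : ℝ) =
      -inner ℝ (V x) (leviCivita I M (fun y ↦ J y (W y)) x u - J x (leviCivita I M W x u)) := by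
  have h1 := mvfderiv_inner u (hJ.mdifferentiableAt_map hV) hW
  have h2 := mvfderiv_inner u hV (hJ.mdifferentiableAt_map hW)
  have h3 : (fun y ↦ (inner ℝ (J y (V y)) (W y) : ℝ)) = fun y ↦ -inner ℝ (V y) (J y (W y)) :=
    funext fun y ↦ hJ.inner_map_left y _ _
  have h4 : mvfderiv I (fun y ↦ -(inner ℝ (V y) (J y (W y)) : ℝ)) x u =
      -mvfderiv I (fun y ↦ (inner ℝ (V y) (J y (W y)) : ℝ)) x u := by
    have := mvfderiv_neg (I := I) (x := x) (g := fun y ↦ (inner ℝ (V y) (J y (W y)) : ℝ))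
    exact congr($this u)
  rw [h3, h4, h2, hJ.inner_map_left] at h1
  rw [inner_sub_left, inner_sub_right, hJ.inner_map_left]
  linarith

variable (J) in
/-- The covariant derivative `(∇_u J) v`, computed with the field `extend E v`. -/
def covDerivEnd (x : M) (u v : TangentSpace I x) : TangentSpace I x :=
  leviCivita I M (fun y ↦ J y (extend E v y)) x u - J x (leviCivita I M (extend E v) x u)

theorem IsHermitian.inner_covDerivEnd (hJ : IsHermitian J) {x : M} (u v w : TangentSpace I x) :
    (inner ℝ (covDerivEnd J x u v) w : ℝ) = -inner ℝ v (covDerivEnd J x u w) := by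
  have := hJ.inner_leviCivita_map_sub u (mdifferentiableAt_extend I E v)
    (mdifferentiableAt_extend I E w)
  rwa [extend_apply_self, extend_apply_self] at this

/-- The covariant derivative `∇J` as a bilinear map. -/
def IsHermitian.covDeriv (hJ : IsHermitian J) (x : M) :
    TangentSpace I x →ₗ[ℝ] TangentSpace I x →ₗ[ℝ] TangentSpace I x :=
  have hadd (u u' v : TangentSpace I x) :
      covDerivEnd J x (u + u') v = covDerivEnd J x u v + covDerivEnd J x u' v := by
    simp only [covDerivEnd, map_add]
    abel
  have hsmul (c : ℝ) (u v : TangentSpace I x) :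
      covDerivEnd J x (c • u) v = c • covDerivEnd J x u v := by
    simp only [covDerivEnd, map_smul, smul_sub]
  LinearMap.mk₂ ℝ (covDerivEnd J x) hadd hsmul
    (fun u v v' ↦ ext_inner_right ℝ fun w ↦ by
      simp only [hJ.inner_covDerivEnd, inner_add_left]
      ring)
    (fun c u v ↦ ext_inner_right ℝ fun w ↦ by
      simp only [hJ.inner_covDerivEnd, real_inner_smul_left]
      ring)

theorem IsHermitian.inner_covDeriv (hJ : IsHermitian J) {x : M} (u v w : TangentSpace I x) :
    (inner ℝ (hJ.covDeriv x u v) w : ℝ) = -inner ℝ v (hJ.covDeriv x u w) :=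
  hJ.inner_covDerivEnd u v w

theorem IsHermitian.leviCivita_map (hJ : IsHermitian J) {x : M} (u : TangentSpace I x)
    {V : Π y : M, TangentSpace I y} (hV : MDiffAt (T% V) x) :
    leviCivita I M (fun y ↦ J y (V y)) x u =
      J x (leviCivita I M V x u) + hJ.covDeriv x u (V x) := by
  refine eq_add_of_sub_eq' (ext_inner_right ℝ fun w ↦ ?_)
  have := hJ.inner_leviCivita_map_sub u hV (mdifferentiableAt_extend I E w)
  rw [extend_apply_self] at this
  rw [this, hJ.inner_covDeriv]
  rfl

/-- This is the derivative of J² = -1. -/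
theorem IsHermitian.covDeriv_map_right (hJ : IsHermitian J) {x : M} (u v : TangentSpace I x) :
    hJ.covDeriv x u (J x v) = -J x (hJ.covDeriv x u v) := by
  have hv := mdifferentiableAt_extend I E v
  have h1 := hJ.leviCivita_map u (hJ.mdifferentiableAt_map hv)
  simp only [hJ.sq] at h1
  rw [leviCivita_neg hv, hJ.leviCivita_map u hv, extend_apply_self, map_add, hJ.sq] at h1
  rw [add_assoc, left_eq_add] at h1
  exact eq_neg_of_add_eq_zero_right h1

/-- On a Hermitian manifold, `∇_{Ju} J = J ∇_u J`. -/
theorem IsHermitian.covDeriv_map_left (hJ : IsHermitian J) {x : M} (u v : TangentSpace I x) :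
    hJ.covDeriv x (J x u) v = J x (hJ.covDeriv x u v) := by
  let P (u v : TangentSpace I x) := hJ.covDeriv x (J x u) v - J x (hJ.covDeriv x u v)
  -- With brackets written through the torsion-free connection, P u v - P v u is the Nijenhuis
  -- tensor.
  have hsymm (u v : TangentSpace I x) : P u v = P v u := by
    have hu := mdifferentiableAt_extend I E u
    have hv := mdifferentiableAt_extend I E v
    have hJu := hJ.mdifferentiableAt_map hu
    have hJv := hJ.mdifferentiableAt_map hv
    have h := hJ.integrable _ _ x hu hv
    rw [nijenhuis, ← leviCivita_sub_swap hJu hJv, ← leviCivita_sub_swap hu hv,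
      ← leviCivita_sub_swap hJu hv, ← leviCivita_sub_swap hu hJv] at h
    simp only [hJ.leviCivita_map _ hu, hJ.leviCivita_map _ hv, extend_apply_self, map_add,
      map_sub, hJ.sq] at h
    rw [← sub_eq_zero, ← h]
    simp only [P]
    abel
  have hskew (u v w : TangentSpace I x) : (inner ℝ (P u v) w : ℝ) = -inner ℝ v (P u w) := by
    simp only [P, inner_sub_left, inner_sub_right]
    rw [hJ.inner_covDeriv, hJ.inner_map_left, hJ.inner_covDeriv, hJ.covDeriv_map_right,
      inner_neg_right]
    ring
  -- A form symmetric in the first two arguments and skew in the last two equals its own negative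
  -- after three rounds of exchanges.
  have hzero (u v w : TangentSpace I x) : (inner ℝ (P u v) w : ℝ) = 0 := by
    have e1 := hskew u v w
    have e2 := hskew w u v
    have e3 := hskew v w u
    rw [hsymm u w, real_inner_comm] at e1
    rw [hsymm w v, real_inner_comm] at e2
    rw [hsymm v u, real_inner_comm] at e3
    have c1 : (inner ℝ w (P u v) : ℝ) = inner ℝ (P u v) w := real_inner_comm _ _
    have c2 : (inner ℝ v (P w u) : ℝ) = inner ℝ (P w u) v := real_inner_comm _ _
    have c3 : (inner ℝ u (P v w) : ℝ) = inner ℝ (P v w) u := real_inner_comm _ _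
    linarith
  exact sub_eq_zero.1 (ext_inner_right ℝ fun w ↦ by rw [hzero, inner_zero_left])

end AlmostComplex

/-! ### The Lee form and its dual field -/

section LeeForm

open Filter Topology

variable {E : Type*} [NormedAddCommGroup E] [NormedSpace ℝ E]
  {H : Type*} [TopologicalSpace H] {I : ModelWithCorners ℝ E H}
  {M : Type*} [TopologicalSpace M] [ChartedSpace H M] [IsManifold I ∞ M]

/-- The orthonormal bases in the codifferential are chosen pointwise, with no smoothness in the
point. Traces in a smooth local frame make the smoothness of the Lee field accessible. -/
theorem trace_eq_sum_localFrameCoeff {ι : Type*} [Fintype ι] (b : Module.Basis ι ℝ E) {x y : M}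
    (hy : y ∈ (chartAt H x).source) (A : TangentSpace I y →ₗ[ℝ] TangentSpace I y) :
    LinearMap.trace ℝ (TangentSpace I y) A =
      ∑ i, (trivializationAt E (TangentSpace I) x).localFrameCoeff I b i y
        (A (extend E (frameVector I b x i) y)) := by
  classical
  have hy' : y ∈ (trivializationAt E (TangentSpace I) x).baseSet := by simpa using hy
  rw [LinearMap.trace_eq_matrix_trace ℝ
    ((trivializationAt E (TangentSpace I) x).basisAt b hy'), Matrix.trace]
  refine Finset.sum_congr rfl fun i _ ↦ ?_
  rw [Matrix.diag_apply, LinearMap.toMatrix_apply, ← localFrame_eq_extend b hy,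
    Trivialization.localFrame_apply_of_mem_baseSet _ _ hy']
  have := Trivialization.localFrameCoeff_apply_of_mem_baseSet (I := I) _ b hy'
    (extend E (A ((trivializationAt E (TangentSpace I) x).basisAt b hy' i))) i
  rw [extend_apply_self] at this
  exact this.symm

variable [FiniteDimensional ℝ E] [RiemannianBundle (fun x : M ↦ TangentSpace I x)]
  [IsContMDiffRiemannianBundle I ∞ E (fun x : M ↦ TangentSpace I x)]
  {J : Π x : M, TangentSpace I x →L[ℝ] TangentSpace I x}

theorem IsHermitian.covDerivTwo_fundamentalForm (hJ : IsHermitian J) (x : M)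
    (u v w : TangentSpace I x) :
    covDerivTwo (fundamentalForm J) x u v w = inner ℝ (hJ.covDeriv x u v) w := by
  have hv := mdifferentiableAt_extend I E v
  have h := mvfderiv_inner u (hJ.mdifferentiableAt_map hv) (mdifferentiableAt_extend I E w)
  simp only [covDerivTwo, fundamentalForm]
  rw [h, hJ.leviCivita_map u hv, extend_apply_self, extend_apply_self, inner_add_left]
  ring

theorem IsHermitian.codiffTwo_fundamentalForm (hJ : IsHermitian J) (x : M)
    (w : TangentSpace I x) :
    codiffTwo (fundamentalForm J) x w =
      LinearMap.trace ℝ (TangentSpace I x) ((hJ.covDeriv x).flip w) := by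
  rw [codiffTwo, LinearMap.trace_eq_sum_inner _ (stdOrthonormalBasis ℝ (TangentSpace I x)),
    ← Finset.sum_neg_distrib]
  refine Finset.sum_congr rfl fun i _ ↦ ?_
  rw [hJ.covDerivTwo_fundamentalForm, hJ.inner_covDeriv, neg_neg]
  rfl

theorem IsHermitian.leeForm_apply (hJ : IsHermitian J) (x : M) (w : TangentSpace I x) :
    leeForm J x w =
      -LinearMap.trace ℝ (TangentSpace I x) ((hJ.covDeriv x).flip (J x w)) := by
  rw [leeForm, actOne, hJ.codiffTwo_fundamentalForm]

/-- The Lee field, metrically dual to the Lee form. -/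
def leeField (J : Π x : M, TangentSpace I x →L[ℝ] TangentSpace I x) (x : M) : TangentSpace I x :=
  ∑ i, leeForm J x (stdOrthonormalBasis ℝ (TangentSpace I x) i) •
    stdOrthonormalBasis ℝ (TangentSpace I x) i

theorem IsHermitian.inner_leeField (hJ : IsHermitian J) (x : M) (w : TangentSpace I x) :
    (inner ℝ (leeField J x) w : ℝ) = leeForm J x w := by
  let F : TangentSpace I x →ₗ[ℝ] ℝ :=
    -(LinearMap.trace ℝ (TangentSpace I x)) ∘ₗ (hJ.covDeriv x).flip ∘ₗ (J x : _ →ₗ[ℝ] _)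
  have hF (w : TangentSpace I x) : leeForm J x w = F w := hJ.leeForm_apply x w
  simp only [leeField, sum_inner, real_inner_smul_left, hF]
  conv_rhs => rw [← (stdOrthonormalBasis ℝ (TangentSpace I x)).sum_repr' w]
  simp [mul_comm]

theorem normSqOne_leeForm (hJ : IsHermitian J) (x : M) :
    normSqOne (leeForm J) x = ‖leeField J x‖ ^ 2 := by
  rw [← (stdOrthonormalBasis ℝ (TangentSpace I x)).sum_sq_inner_left]
  simp only [normSqOne, hJ.inner_leeField]

variable [I.Boundaryless]

theorem IsHermitian.contMDiffAt_leeField (hJ : IsHermitian J) (x : M) :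
    CMDiffAt ∞ (T% (leeField J)) x := by
  refine contMDiffAt_of_inner_extend fun w ↦ ?_
  let b := Module.finBasis ℝ E
  have hx := FiberBundle.mem_baseSet_trivializationAt E (TangentSpace I) x
  -- Since J² = -1, this field is -(∇_{e_i} J)(JW), whose i-th coefficients sum to ⟨T, W⟩; in this
  -- form it is visibly smooth.
  let S (i) (y : M) : TangentSpace I y :=
    leviCivita I M (extend E w) y (extend E (frameVector I b x i) y)
      + J y (leviCivita I M (fun y ↦ J y (extend E w y)) y (extend E (frameVector I b x i) y))
  have hw := contMDiffAt_extend_tangent w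
  have hS (i) : CMDiffAt ∞ (T% (S i)) x :=
    (contMDiffAt_leviCivita_extend _ hw).add_section
      (hJ.contMDiffAt_map (contMDiffAt_leviCivita_extend _ (hJ.contMDiffAt_map hw)))
  refine (ContMDiffAt.sum (t := Finset.univ) fun i _ ↦
    contMDiffAt_localFrameCoeff b hx (hS i) i).congr_of_eventuallyEq ?_
  filter_upwards [eventually_mem_chartAt_source (H := H) x, eventually_mdifferentiableAt_extend w]
    with y hy hwy
  rw [hJ.inner_leeField, hJ.leeForm_apply, trace_eq_sum_localFrameCoeff b hy,
    ← Finset.sum_neg_distrib]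
  refine Finset.sum_congr rfl fun i _ ↦ ?_
  rw [← map_neg]
  refine congrArg _ ?_
  have h := hJ.leviCivita_map (extend E (frameVector I b x i) y) (hJ.mdifferentiableAt_map hwy)
  simp only [hJ.sq] at h
  rw [leviCivita_neg hwy] at h
  simp only [LinearMap.flip_apply, S]
  rw [eq_sub_of_add_eq' h.symm]
  abel

theorem IsHermitian.mdifferentiableAt_leeField (hJ : IsHermitian J) (x : M) :
    MDiffAt (T% (leeField J)) x :=
  (hJ.contMDiffAt_leeField x).mdifferentiableAt (by simp)

theorem IsHermitian.covDerivOne_leeForm (hJ : IsHermitian J) (x : M) (v w : TangentSpace I x) :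
    covDerivOne (leeForm J) x v w = inner ℝ (leviCivita I M (leeField J) x v) w := by
  have h := mvfderiv_inner v (hJ.mdifferentiableAt_leeField x) (mdifferentiableAt_extend I E w)
  simp only [covDerivOne, ← hJ.inner_leeField]
  rw [h, extend_apply_self]
  ring

theorem IsHermitian.codiffOne_leeForm (hJ : IsHermitian J) (x : M) :
    codiffOne (leeForm J) x =
      -LinearMap.trace ℝ (TangentSpace I x) (leviCivita I M (leeField J) x : _ →ₗ[ℝ] _) := by
  rw [codiffOne, LinearMap.trace_eq_sum_inner _ (stdOrthonormalBasis ℝ (TangentSpace I x))]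
  simp only [hJ.covDerivOne_leeForm, ContinuousLinearMap.coe_coe]
  simp only [real_inner_comm]

end LeeForm

/-! ### The second derivative of J and the Ricci identity on a Hermitian surface -/

section Surface

open Filter Topology

variable {E : Type*} [NormedAddCommGroup E] [NormedSpace ℝ E] [FiniteDimensional ℝ E]
  {H : Type*} [TopologicalSpace H] {I : ModelWithCorners ℝ E H}
  {M : Type*} [TopologicalSpace M] [ChartedSpace H M] [IsManifold I ∞ M]
  [RiemannianBundle (fun x : M ↦ TangentSpace I x)]
  [IsContMDiffRiemannianBundle I ∞ E (fun x : M ↦ TangentSpace I x)]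
  {J : Π x : M, TangentSpace I x →L[ℝ] TangentSpace I x}

/-- On a Hermitian surface, `∇J` is determined by the Lee field. -/
theorem IsHermitian.covDeriv_eq (hJ : IsHermitian J) (hE : Module.finrank ℝ E = 4) {x : M}
    (u v : TangentSpace I x) :
    hJ.covDeriv x u v = (2⁻¹ : ℝ) • ((inner ℝ u v : ℝ) • J x (leeField J x)
      - (inner ℝ (J x (leeField J x)) v : ℝ) • u + (inner ℝ (J x u) v : ℝ) • leeField J x
      - (inner ℝ (leeField J x) v : ℝ) • J x u) := by
  have hE' : Module.finrank ℝ (TangentSpace I x) = 4 := hE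
  let J' : TangentSpace I x →ₗ[ℝ] TangentSpace I x := J x
  have hsq (v : TangentSpace I x) : J' (J' v) = -v := hJ.sq x v
  have horth (v w : TangentSpace I x) : (inner ℝ (J' v) (J' w) : ℝ) = inner ℝ v w :=
    hJ.orthogonal x v w
  have hright (u v : TangentSpace I x) : hJ.covDeriv x u (J' v) = -J' (hJ.covDeriv x u v) :=
    hJ.covDeriv_map_right u v
  have hleft (u v : TangentSpace I x) : hJ.covDeriv x (J' u) v = J' (hJ.covDeriv x u v) :=
    hJ.covDeriv_map_left u v
  have htr (w : TangentSpace I x) : (inner ℝ (leeField J x) w : ℝ) =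
      -LinearMap.trace ℝ (TangentSpace I x) ((hJ.covDeriv x).flip (J' w)) := by
    rw [hJ.inner_leeField, hJ.leeForm_apply]
    rfl
  have := two_smul_eq_of_trace hE' hsq horth hJ.inner_covDeriv hright hleft htr u v
  rw [eq_inv_smul_iff₀ two_ne_zero]
  exact this

theorem IsHermitian.inner_covDeriv_eq (hJ : IsHermitian J) (hE : Module.finrank ℝ E = 4) {x : M}
    (u v z : TangentSpace I x) :
    (inner ℝ (hJ.covDeriv x u v) z : ℝ) =
      covDerivForm (J x : _ →ₗ[ℝ] _) (leeField J x) u v z := by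
  rw [hJ.covDeriv_eq hE]
  simp only [covDerivForm, inner_add_left, inner_sub_left, real_inner_smul_left,
    ContinuousLinearMap.coe_coe]

theorem leviCivita_inner_smul {x : M} (u : TangentSpace I x) {A B C : Π y : M, TangentSpace I y}
    (hA : MDiffAt (T% A) x) (hB : MDiffAt (T% B) x) (hC : MDiffAt (T% C) x) :
    leviCivita I M (fun y ↦ (inner ℝ (A y) (B y) : ℝ) • C y) x u =
      (inner ℝ (A x) (B x) : ℝ) • leviCivita I M C x u
        + (inner ℝ (leviCivita I M A x u) (B x) + inner ℝ (A x) (leviCivita I M B x u) : ℝ) •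
          C x := by
  rw [leviCivita_smul (mdifferentiableAt_inner hA hB) hC, mvfderiv_inner u hA hB]

variable [I.Boundaryless]

/-- The product rule applied to the formula for ∇J. Terms differentiating V or W regroup into ∇J;
those differentiating J or T make up ∇²J. -/
theorem IsHermitian.inner_leviCivita_covDeriv (hJ : IsHermitian J)
    (hE : Module.finrank ℝ E = 4) {x : M} (u z : TangentSpace I x)
    {V W : Π y : M, TangentSpace I y} (hV : MDiffAt (T% V) x) (hW : MDiffAt (T% W) x) :
    (inner ℝ (leviCivita I M (fun y ↦ hJ.covDeriv y (V y) (W y)) x u) z : ℝ) =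
      secondCovDerivForm (J x : _ →ₗ[ℝ] _) (leeField J x)
        (leviCivita I M (leeField J) x : _ →ₗ[ℝ] _) u (V x) (W x) z
      + inner ℝ (hJ.covDeriv x (leviCivita I M V x u) (W x)) z
      + inner ℝ (hJ.covDeriv x (V x) (leviCivita I M W x u)) z := by
  have hT := hJ.mdifferentiableAt_leeField x
  have hJT := hJ.mdifferentiableAt_map hT
  have hJV := hJ.mdifferentiableAt_map hV
  have a1 := (mdifferentiableAt_inner hV hW).smul_section hJT
  have a2 := (mdifferentiableAt_inner hJT hW).smul_section hV
  have a3 := (mdifferentiableAt_inner hJV hW).smul_section hT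
  have a4 := (mdifferentiableAt_inner hT hW).smul_section hJV
  have a12 := mdifferentiableAt_sub_section a1 a2
  have a123 := mdifferentiableAt_add_section a12 a3
  have a1234 := mdifferentiableAt_sub_section a123 a4
  have h : leviCivita I M (fun y ↦ hJ.covDeriv y (V y) (W y)) x u = (2⁻¹ : ℝ) •
      (leviCivita I M (fun y ↦ (inner ℝ (V y) (W y) : ℝ) • J y (leeField J y)) x u
      - leviCivita I M (fun y ↦ (inner ℝ (J y (leeField J y)) (W y) : ℝ) • V y) x u
      + leviCivita I M (fun y ↦ (inner ℝ (J y (V y)) (W y) : ℝ) • leeField J y) x u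
      - leviCivita I M (fun y ↦ (inner ℝ (leeField J y) (W y) : ℝ) • J y (V y)) x u) := by
    simp only [hJ.covDeriv_eq hE]
    exact (leviCivita_const_smul _ a1234 u).trans (congrArg _ ((leviCivita_sub a123 a4 u).trans
      (congrArg (· - _) ((leviCivita_add a12 a3 u).trans
        (congrArg (· + _) (leviCivita_sub a1 a2 u))))))
  rw [h, leviCivita_inner_smul u hV hW hJT, leviCivita_inner_smul u hJT hW hV,
    leviCivita_inner_smul u hJV hW hT, leviCivita_inner_smul u hT hW hJV,
    hJ.leviCivita_map u hT, hJ.leviCivita_map u hV]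
  simp only [inner_covDeriv_eq hJ hE, secondCovDerivForm, inner_add_left, inner_sub_left,
    real_inner_smul_left, ContinuousLinearMap.coe_coe]
  simp only [covDerivForm, ContinuousLinearMap.coe_coe]
  ring

/-- The Ricci identity for J; the plus sign arises because J is skew. -/
theorem IsHermitian.riemann_map_add (hJ : IsHermitian J) (hE : Module.finrank ℝ E = 4) {x : M}
    (u v w z : TangentSpace I x) :
    riemann x u v (J x w) z + riemann x u v w (J x z) =
      alternatedForm (J x : _ →ₗ[ℝ] _) (leeField J x)
        (leviCivita I M (leeField J) x : _ →ₗ[ℝ] _) u v w z := by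
  have hw := contMDiffAt_extend_tangent w
  have hJw := hJ.contMDiffAt_map hw
  have h1 := riemann_eq_inner_curvature u v z hJw
  rw [extend_apply_self] at h1
  -- The Leibniz rule twice on ∇_u∇_v(JW). Upon alternation the two terms with one derivative on W
  -- cancel as a pair, and those with ∇_u V cancel by `hcomm`.
  have key (u v : TangentSpace I x) :
      inner ℝ (leviCivita I M (fun y ↦ leviCivita I M (fun y ↦ J y (extend E w y)) y
        (extend E v y)) x u) z =
      inner ℝ (J x (leviCivita I M (fun y ↦ leviCivita I M (extend E w) y (extend E v y)) x u)) z
      + inner ℝ (hJ.covDeriv x u (leviCivita I M (extend E w) x v)) z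
      + (secondCovDerivForm (J x : _ →ₗ[ℝ] _) (leeField J x)
        (leviCivita I M (leeField J) x : _ →ₗ[ℝ] _) u v w z
      + inner ℝ (hJ.covDeriv x (leviCivita I M (extend E v) x u) w) z
      + inner ℝ (hJ.covDeriv x v (leviCivita I M (extend E w) x u)) z) := by
    have hv := mdifferentiableAt_extend I E v
    have hLw := mdifferentiableAt_leviCivita_extend v hw
    have hLJw := mdifferentiableAt_leviCivita_extend v hJw
    have hJLw := hJ.mdifferentiableAt_map hLw
    have heq : (fun y ↦ hJ.covDeriv y (extend E v y) (extend E w y)) =ᶠ[𝓝 x] fun y ↦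
        leviCivita I M (fun y ↦ J y (extend E w y)) y (extend E v y)
          - J y (leviCivita I M (extend E w) y (extend E v y)) := by
      filter_upwards [eventually_mdifferentiableAt_extend w] with y hwy
      rw [hJ.leviCivita_map _ hwy, add_sub_cancel_left]
    have hsub : MDiffAt (T% (fun y ↦
        leviCivita I M (fun y ↦ J y (extend E w y)) y (extend E v y)
          - J y (leviCivita I M (extend E w) y (extend E v y)))) x :=
      mdifferentiableAt_sub_section hLJw hJLw
    have hD : MDiffAt (T% (fun y ↦ hJ.covDeriv y (extend E v y) (extend E w y))) x := by
      refine hsub.congr_of_eventuallyEq ?_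
      filter_upwards [heq] with y hy
      rw [hy]
    have hF := hJ.inner_leviCivita_covDeriv hE u z hv (mdifferentiableAt_extend I E w)
    rw [leviCivita_congr hD hsub heq] at hF
    have h2 := leviCivita_sub hLJw hJLw u
    rw [hJ.leviCivita_map u hLw] at h2
    rw [extend_apply_self, extend_apply_self] at hF
    rw [← hF, h2, extend_apply_self, inner_sub_left, inner_add_left]
    ring
  have hcomm : leviCivita I M (extend E v) x u = leviCivita I M (extend E u) x v := by
    have := (eventually_leviCivita_extend_comm v u).self_of_nhds
    simp only [extend_apply_self] at this
    exact this
  rw [h1, riemann, curvature_extend, curvature_extend, inner_sub_left, inner_sub_left,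
    key u v, key v u, hcomm, hJ.inner_map_left, hJ.inner_map_left, alternatedForm]
  ring

end Surface

end HermitianSurface

end

/-! ### The characterization of Gray's first condition, point by point -/

theorem proposition5p6 {M : Type*} [TopologicalSpace M] [ChartedSpace (EuclideanSpace ℝ (Fin 4)) M]
    [IsManifold (𝓡 4) ∞ M]
    [RiemannianBundle (fun x : M ↦ TangentSpace (𝓡 4) x)]
    [IsContMDiffRiemannianBundle (𝓡 4) ∞ (EuclideanSpace ℝ (Fin 4))
      (fun x : M ↦ TangentSpace (𝓡 4) x)]
    (J : Π x : M, TangentSpace (𝓡 4) x →L[ℝ] TangentSpace (𝓡 4) x)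
    (hJ : HermitianSurface.IsHermitian J)
    (θ : Π x : M, TangentSpace (𝓡 4) x → ℝ) (hθ : θ = HermitianSurface.leeForm J) :
    HermitianSurface.GrayFirst J ↔
      (∀ x : M, 2 * HermitianSurface.codiffOne θ x = -HermitianSurface.normSqOne θ x) ∧
      (∀ (x : M) (v w : TangentSpace (𝓡 4) x),
        HermitianSurface.antiInvariantPart J (HermitianSurface.covDerivOne θ) x v w =
          -(1 / 4) * (θ x v * θ x w
            - HermitianSurface.actOne J θ x v * HermitianSurface.actOne J θ x w)) := by
  subst hθ
  rw [HermitianSurface.GrayFirst, ← forall_and]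
  refine forall_congr' fun x ↦ ?_
  have hE : Module.finrank ℝ (EuclideanSpace ℝ (Fin 4)) = 4 := by simp
  let J' : TangentSpace (𝓡 4) x →ₗ[ℝ] TangentSpace (𝓡 4) x := J x
  let B : TangentSpace (𝓡 4) x →ₗ[ℝ] TangentSpace (𝓡 4) x :=
    HermitianSurface.leviCivita (𝓡 4) M (HermitianSurface.leeField J) x
  have hsq (v : TangentSpace (𝓡 4) x) : J' (J' v) = -v := hJ.sq x v
  have horth (v w : TangentSpace (𝓡 4) x) : (inner ℝ (J' v) (J' w) : ℝ) = inner ℝ v w :=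
    hJ.orthogonal x v w
  have hE' : Module.finrank ℝ (TangentSpace (𝓡 4) x) = 4 := hE
  have key := HermitianSurface.forall_commutator_eq_zero_iff hE' hsq horth
    (HermitianSurface.leeField J x) B (HermitianSurface.riemann x)
    HermitianSurface.riemann_pair_symm HermitianSurface.riemann_neg_middle
    HermitianSurface.riemann_neg_right (hJ.riemann_map_add hE)
  refine key.trans (and_congr ?_ ?_)
  -- Here δθ is minus the trace of B, which accounts for the sign of |θ|².
  · rw [hJ.codiffOne_leeForm, HermitianSurface.normSqOne_leeForm hJ]
    constructor <;> intro h <;> linarith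
  · refine forall_congr' fun v ↦ forall_congr' fun w ↦ ?_
    simp only [HermitianSurface.antiInvariantPart, HermitianSurface.actOne,
      hJ.covDerivOne_leeForm, ← hJ.inner_leeField, neg_mul_neg]
    rfl
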